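/- Let $K$ be an arbitrary field and let $\Lambda=\Lambda(x_i\mid i\ge 0)$ be the Grassmann algebra over $K$ in countably many letters, with its $\mathbb Z_2$-grading in which all $x_i$ are odd. Let $\partial_i$ be the (odd, left) superderivative of $\Lambda$ with $\partial_i(x_j)=\delta_{ij}$, and identify $x_i$ with the operator of left multiplication by $x_i$. Define the operators $$v_i=\partial_i+x_ix_{i+1}\bigl(\partial_{i+2}+x_{i+2}x_{i+3}(\partial_{i+4}+x_{i+4}x_{i+5}(\partial_{i+6}+\cdots))\bigr)\in\operatorname{End}\Lambda,\qquad i\ge 0$$ (on each element of $\Lambda$ only finitely many summands are nonzero). Let $\mathbf A=\operatorname{Alg}(v_0,v_1)\subset\operatorname{End}\Lambda$ be the associative algebra without unit generated by $v_0,v_1$, and let $\mathbf R=\operatorname{Lie}(v_0,v_1)\subset \operatorname{End}\Lambda$ be the Lie superalgebra generated by $v_0,v_1$, i.e. the smallest subspace containing $v_0,v_1$ that is closed under the supercommutator $[a,b]=ab-(-1)^{\deg a\deg b}ba$ and under the quadratic map $a\mapsto a^2$ on odd elements (the latter closure is automatic if $\operatorname{char}K\neq 2$). A monomial is any (Lie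 or associative) product of letters $x_i,\partial_i,v_i$, $i\ge0$. Its superweight is determined by additivity on products and $\operatorname{swt}(\partial_i)=\operatorname{swt}(v_i)=-\operatorname{swt}(x_i)=(-1)^i$. For $L\in\{\mathbf R,\mathbf A\}$ let $L_+,L_0,L_-$ be the linear spans of the monomials that lie in $L$ and have positive, zero, negative superweight, respectively. An associative algebra is called locally nilpotent if every finitely generated (non-unital) subalgebra $B$ satisfies $B^n=0$ for some $n\ge1$. A Lie superalgebra of operators is called locally nilpotent if for every finitely generated subalgebra $B$ (a subspace closed under the supercommutator and under squares of odd elements) some term $B^n$ of its lower central series is zero, where $B^1=B$ and, for $n\ge 2$, $B^n=[B,B^{n-1}]+\langle a^2\mid a\in B^{\lceil n/2\rceil}\text{ odd}\rangle_K$ (the squares are needed only if $\operatorname{char}K=2$). Then: 1. $\mathbf A=\mathbf A_+\oplus\mathbf A_0\oplus\mathbf A_-$ is a direct sum of three subalgebras, and $\mathbf A_+$, $\mathbf A_-$ are locally nilpotent; 2. $\mathbf R=\mathbf R_+\oplus\mathbf R_0\oplus\mathbf R_-$ is a direct sum of three subalgebras, and $\mathbf R_+$, $\mathbf R_0$, $\mathbf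 R_-$ are all locally nilpotent. -/

import Mathlib

namespace GrassmannPivot

noncomputable section

variable (K : Type*) [Field K]

/-- The Grassmann algebra `Λ = Λ(x_i | i ≥ 0)` in countably many letters. -/
abbrev Grassmann : Type _ := ExteriorAlgebra K (ℕ →₀ K)

/-- The `ℤ/2`-grading `Λ = Λ_0 ⊕ Λ_1`, all letters `x_i` being odd. -/
abbrev parity (a : ZMod 2) : Submodule K (Grassmann K) :=
  CliffordAlgebra.evenOdd (0 : QuadraticForm K (ℕ →₀ K)) a

/-- The letter `x_i`, identified with the operator of left multiplication by `x_i` on `Λ`. -/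
def letter (i : ℕ) : Module.End K (Grassmann K) :=
  LinearMap.mulLeft K (ExteriorAlgebra.ι K (Finsupp.single i (1 : K)))

/-- The superderivative `∂_i` of `Λ`: the left (odd) derivation with `∂_i (x_j) = δ_{ij}`. -/
def partialD (i : ℕ) : Module.End K (Grassmann K) :=
  CliffordAlgebra.contractLeft (Q := (0 : QuadraticForm K (ℕ →₀ K))) (Finsupp.lapply i)

/-- The `k`-th summand `x_i x_{i+1} ⋯ x_{i+2k-1} ∂_{i+2k}` of the pivot element `v_i`. -/
def pivotTerm : ℕ → ℕ → Module.End K (Grassmann K)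
  | i, 0 => partialD K i
  | i, k + 1 => letter K i * letter K (i + 1) * pivotTerm (i + 2) k

theorem partialD_eventually_zero (f : Grassmann K) :
    ∃ N : ℕ, ∀ j, N ≤ j → partialD K j f = 0 := by
  induction f using CliffordAlgebra.left_induction with
  | algebraMap r => exact ⟨0, fun j _ => CliffordAlgebra.contractLeft_algebraMap _ _ r⟩
  | add a b ha hb =>
    obtain ⟨M, hM⟩ := ha
    obtain ⟨N, hN⟩ := hb
    refine ⟨max M N, fun j hj => ?_⟩
    rw [map_add, hM j (le_trans (le_max_left _ _) hj), hN j (le_trans (le_max_right _ _) hj),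
      add_zero]
  | ι_mul a m ha =>
    obtain ⟨M, hM⟩ := ha
    refine ⟨max M (m.support.sup id + 1), fun j hj => ?_⟩
    have h1 : partialD K j a = 0 := hM j (le_trans (le_max_left _ _) hj)
    have h2 : m j = 0 := by
      by_contra h
      have h3 : j ≤ m.support.sup id :=
        Finset.le_sup (f := id) (Finsupp.mem_support_iff.mpr h)
      have h4 := le_trans (le_max_right _ _) hj
      omega
    unfold partialD at h1 ⊢
    rw [CliffordAlgebra.contractLeft_ι_mul, h1, Finsupp.lapply_apply, h2, zero_smul, mul_zero,
      sub_zero]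

theorem pivotTerm_apply_eq_zero (k : ℕ) : ∀ (i : ℕ) (f : Grassmann K),
    partialD K (i + 2 * k) f = 0 → pivotTerm K i k f = 0 := by
  induction k with
  | zero => intro i f h; simpa [pivotTerm] using h
  | succ k ih =>
    intro i f h
    have h1 : pivotTerm K (i + 2) k f = 0 := ih (i + 2) f (by
      rwa [show i + 2 + 2 * k = i + 2 * (k + 1) by ring])
    simp [pivotTerm, h1]

theorem pivotTerm_hasFiniteSupport (i : ℕ) (f : Grassmann K) :
    (fun k => pivotTerm K i k f).HasFiniteSupport := by
  obtain ⟨N, hN⟩ := partialD_eventually_zero K f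
  refine (Set.finite_lt_nat N).subset fun k hk => ?_
  by_contra h
  refine hk (pivotTerm_apply_eq_zero K k i f (hN _ ?_))
  have : N ≤ k := not_lt.mp h
  omega

/-- The pivot element
`v_i = ∂_i + x_i x_{i+1} (∂_{i+2} + x_{i+2} x_{i+3} (∂_{i+4} + ⋯))`, as an operator on `Λ`.
On each element of `Λ` only finitely many summands are nonzero. -/
def pivot (i : ℕ) : Module.End K (Grassmann K) where
  toFun f := ∑ᶠ k, pivotTerm K i k f
  map_add' f g := by
    simp only [map_add]
    exact finsum_add_distrib (pivotTerm_hasFiniteSupport K i f) (pivotTerm_hasFiniteSupport K i g)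
  map_smul' c f := by
    simp only [map_smul, RingHom.id_apply]
    exact (smul_finsum' c (pivotTerm_hasFiniteSupport K i f)).symm

variable {K}

/-- The component of parity `a` of an operator `φ` with respect to
`End Λ = End_0 Λ ⊕ End_1 Λ`, where `End_a Λ` consists of the operators mapping `Λ_b` to
`Λ_{a+b}`. -/
def parityPart (a : ZMod 2) (φ : Module.End K (Grassmann K)) :
    Module.End K (Grassmann K) :=
  ∑ b : ZMod 2, GradedAlgebra.proj (parity K) (a + b) ∘ₗ φ ∘ₗ GradedAlgebra.proj (parity K) b

/-- Odd operators: those mapping `Λ_b` to `Λ_{1+b}`. -/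
def IsOdd (φ : Module.End K (Grassmann K)) : Prop :=
  ∀ b : ZMod 2, ∀ f ∈ parity K b, φ f ∈ parity K (1 + b)

/-- The supercommutator of `End Λ`: the bilinear extension of
`[φ, ψ] = φ ψ - (-1)^{deg φ deg ψ} ψ φ` from homogeneous operators. -/
def superBracket (φ ψ : Module.End K (Grassmann K)) :
    Module.End K (Grassmann K) :=
  ∑ a : ZMod 2, ∑ b : ZMod 2,
    (parityPart a φ * parityPart b ψ -
      (-1 : K) ^ (a.val * b.val) • (parityPart b ψ * parityPart a φ))

/-- Subalgebras of the Lie superalgebra `(End Λ)^(-)`: subspaces closed under the supercommutator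
and under the quadratic mapping `x ↦ x²` on odd elements.  If `2` is invertible the second
condition follows from the first because `x² = ½ [x, x]`. -/
structure IsLieSuperSubalgebra (B : Submodule K (Module.End K (Grassmann K))) : Prop where
  bracket_mem : ∀ x ∈ B, ∀ y ∈ B, superBracket x y ∈ B
  sq_mem : ∀ x ∈ B, IsOdd x → x * x ∈ B

/-- `Lie(S)`, the subalgebra of the Lie superalgebra `(End Λ)^(-)` generated by `S`. -/
def lieClosure (S : Set (Module.End K (Grassmann K))) :
    Submodule K (Module.End K (Grassmann K)) :=
  sInf {B | IsLieSuperSubalgebra B ∧ S ⊆ B}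

/-- The lower central series `B¹ = B`, `Bⁿ = [B, Bⁿ⁻¹] + ⟨x² | x ∈ B^⌈n/2⌉ odd⟩` of a Lie
superalgebra of operators (with index `0` also giving `B`).  The squares are needed in
characteristic `2`; if `2` is invertible, then `x² = ½ [x, x]` and they add nothing. -/
def lowerCentral (B : Submodule K (Module.End K (Grassmann K))) :
    ℕ → Submodule K (Module.End K (Grassmann K))
  | 0 => B
  | 1 => B
  | n + 2 => Submodule.span K
      ({z | ∃ x ∈ B, ∃ y ∈ lowerCentral B (n + 1), z = superBracket x y} ∪
        {z | ∃ x ∈ lowerCentral B ((n + 3) / 2), IsOdd x ∧ z = x * x})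
  termination_by n => n
  decreasing_by all_goals omega

/-- A Lie superalgebra of operators is locally nilpotent if every finitely generated subalgebra
is nilpotent, that is, has a vanishing term of its lower central series. -/
def IsLocallyNilpotentLie (L : Submodule K (Module.End K (Grassmann K))) : Prop :=
  ∀ S : Set (Module.End K (Grassmann K)), S.Finite → S ⊆ L →
    ∃ n : ℕ, lowerCentral (lieClosure S) n = ⊥

/-- An associative algebra of operators is locally nilpotent if for every finitely generated
(non-unital) subalgebra `B` there is `n` with `Bⁿ = 0`. -/
def IsLocallyNilpotentAssoc (L : Submodule K (Module.End K (Grassmann K))) : Prop :=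
  ∀ S : Set (Module.End K (Grassmann K)), S.Finite → S ⊆ L →
    ∃ n : ℕ, (NonUnitalAlgebra.adjoin K S).toSubmodule ^ n = ⊥

/-- `IsMonomial s w`: the operator `w` is a monomial of superweight `s`, that is, a (Lie or
associative) product of letters `x_i, ∂_i, v_i`, the superweight being additive on products with
`swt(∂_i) = swt(v_i) = -swt(x_i) = (-1)^i`. -/
inductive IsMonomial : ℤ → Module.End K (Grassmann K) → Prop
  | letter (i : ℕ) : IsMonomial (-(-1) ^ i) (letter K i)
  | partialD (i : ℕ) : IsMonomial ((-1) ^ i) (partialD K i)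
  | pivot (i : ℕ) : IsMonomial ((-1) ^ i) (pivot K i)
  | mul {s t : ℤ} {w u : Module.End K (Grassmann K)} :
      IsMonomial s w → IsMonomial t u → IsMonomial (s + t) (w * u)
  | bracket {s t : ℤ} {w u : Module.End K (Grassmann K)} :
      IsMonomial s w → IsMonomial t u → IsMonomial (s + t) (superBracket w u)

/-- The component of `L` spanned by the monomials that belong to `L` and have superweight of sign
`σ`: for `σ = 1, 0, -1` these are `L_+`, `L_0`, `L_-`. -/
def signPart (L : Submodule K (Module.End K (Grassmann K))) (σ : SignType) :
    Submodule K (Module.End K (Grassmann K)) :=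
  Submodule.span K {w | w ∈ L ∧ ∃ s : ℤ, SignType.sign s = σ ∧ IsMonomial s w}

variable (K)

/-- The Lie superalgebra `R = Lie(v_0, v_1)`. -/
def lieR : Submodule K (Module.End K (Grassmann K)) :=
  lieClosure {pivot K 0, pivot K 1}

/-- The associative hull `A = Alg(v_0, v_1)`, an associative algebra without unit. -/
def algA : Submodule K (Module.End K (Grassmann K)) :=
  (NonUnitalAlgebra.adjoin K {pivot K 0, pivot K 1}).toSubmodule

end

end GrassmannPivot

/-! Superweight grades `Λ` and its operators. Monomials are homogeneous and span `algA` and `lieR`,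
and operators of different superweight are linearly independent, so both algebras split by the sign
of the superweight. Signs are preserved under products, hence each summand is a subalgebra.

Local nilpotency rests on a logarithmic bound. Put `y_n = x_n v_{n+1}` (`pivotSq`). Then `v_n = ∂_n
+ x_n y_{n+1}` and `v_n² = y_{n+1}`, and a product of two elements of `{1, v_n, y_n}` is a
combination of `1, x_n, ∂_n, x_n ∂_n` times at most one of `1, v_{n+1}, y_{n+1}` (`tail_mul_tail`).
Tail operators commute up to sign with `x_i` and `∂_i` of smaller index, so the Clifford factors can
be collected on the left, and each level halves the word length. A word of length `2 ^ e` thus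
becomes a combination of words in `x_i, ∂_i` with `i ≤ e`, each index contributing superweight at
most one in absolute value, followed by one tail operator of superweight at most two. A product of
`N` elements of positive superweight has superweight at least `N`, whereas the bound grows like `log
N`; so it vanishes for large `N` (`exists_pow_eq_bot_of_signed`). The negative part is symmetric.

For `R_0` superweight gives no bound. Its elements are even superderivations sending `x_j` to
polynomials in the earlier letters. By the same reduction, finitely many of them send every `x_j`
with `j ≥ n` into the ideal generated by the letters `x_i`, `i < n`, for a suitable `n`. Give `x_i`
the weight `2n - i` for `i < n` and `0` otherwise: each of these derivations raises the weight,
while a nonzero product of letters is squarefree and so has bounded weight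
(`exists_pow_eq_bot_of_lieR`).

In all cases associative powers of a span of homogeneous operators vanish, and `lowerCentral_eq_bot`
transfers this to the lower central series, squares included, in every characteristic. -/

namespace GrassmannPivot

/-! ### Products of letters and the superderivatives acting on them. -/

section Letters

variable (K : Type*) [Field K]

/-- The generator `x_i` of the Grassmann algebra, as an element. -/
noncomputable def gen (i : ℕ) : Grassmann K := ExteriorAlgebra.ι K (Finsupp.single i (1 : K))

/-- The product of the generators along a list of indices. -/
noncomputable def mono (l : List ℕ) : Grassmann K := (l.map (gen K)).prod

@[simp] theorem mono_nil : mono K [] = 1 := rfl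

theorem mono_cons (i : ℕ) (l : List ℕ) : mono K (i :: l) = gen K i * mono K l := by
  simp [mono]

theorem mono_append (l m : List ℕ) : mono K (l ++ m) = mono K l * mono K m := by
  simp [mono]

theorem gen_mul_self (i : ℕ) : gen K i * gen K i = 0 :=
  ExteriorAlgebra.ι_sq_zero _

theorem gen_mul_gen (i j : ℕ) : gen K i * gen K j = -(gen K j * gen K i) :=
  eq_neg_of_add_eq_zero_left (ExteriorAlgebra.ι_add_mul_swap _ _)

theorem letter_apply (i : ℕ) (f : Grassmann K) : letter K i f = gen K i * f := rfl

theorem ι_mem_span_gen (m : ℕ →₀ K) :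
    CliffordAlgebra.ι (0 : QuadraticForm K (ℕ →₀ K)) m ∈ Submodule.span K (Set.range (gen K)) := by
  induction m using Finsupp.induction_linear with
  | zero => simp
  | add f g hf hg => rw [map_add]; exact add_mem hf hg
  | single i c =>
    rw [← mul_one c, ← smul_eq_mul, ← Finsupp.smul_single, map_smul]
    exact Submodule.smul_mem _ _ (Submodule.subset_span ⟨i, rfl⟩)

theorem span_mono_eq_top : Submodule.span K (Set.range (mono K)) = ⊤ := by
  rw [eq_top_iff]
  rintro f -
  induction f using CliffordAlgebra.left_induction with
  | algebraMap r =>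
    rw [Algebra.algebraMap_eq_smul_one]
    exact Submodule.smul_mem _ _ (Submodule.subset_span ⟨[], rfl⟩)
  | add a b ha hb => exact add_mem ha hb
  | ι_mul a m ha =>
    have h := Submodule.mul_mem_mul (ι_mem_span_gen K m) ha
    rw [Submodule.span_mul_span] at h
    refine Submodule.span_mono ?_ h
    rintro _ ⟨_, ⟨i, rfl⟩, _, ⟨l, rfl⟩, rfl⟩
    exact ⟨i :: l, mono_cons K i l⟩

theorem linearMap_ext_mono {M : Type*} [AddCommMonoid M] [Module K M]
    {φ ψ : Grassmann K →ₗ[K] M} (h : ∀ l, φ (mono K l) = ψ (mono K l)) : φ = ψ :=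
  LinearMap.ext_on (span_mono_eq_top K) (by rintro _ ⟨l, rfl⟩; exact h l)

theorem partialD_one (i : ℕ) : partialD K i 1 = 0 :=
  CliffordAlgebra.contractLeft_one (Q := (0 : QuadraticForm K (ℕ →₀ K))) (Finsupp.lapply i)

theorem partialD_gen_mul (i j : ℕ) (f : Grassmann K) :
    partialD K i (gen K j * f) = (if i = j then 1 else 0 : K) • f - gen K j * partialD K i f := by
  have h := CliffordAlgebra.contractLeft_ι_mul (Q := (0 : QuadraticForm K (ℕ →₀ K)))
    (Finsupp.lapply i) (Finsupp.single j (1 : K)) f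
  simp only [Finsupp.lapply_apply, Finsupp.single_apply, eq_comm (a := j)] at h
  exact h

theorem partialD_gen (i j : ℕ) :
    partialD K i (gen K j) = (if i = j then 1 else 0 : K) • 1 := by
  have h := partialD_gen_mul K i j 1
  rwa [partialD_one, mul_one, mul_zero, sub_zero] at h

theorem partialD_comm (i j : ℕ) (f : Grassmann K) :
    partialD K i (partialD K j f) = -partialD K j (partialD K i f) :=
  CliffordAlgebra.contractLeft_comm _ _ _

theorem partialD_sq (i : ℕ) (f : Grassmann K) : partialD K i (partialD K i f) = 0 :=
  CliffordAlgebra.contractLeft_contractLeft _ _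

end Letters

/-! ### Gradings of the Grassmann algebra and of its operators by integer weights. -/

section Weights

variable (K : Type*) [Field K]

/-- The total weight of a list of indices for the weight function `ω`. -/
def listWeight {A : Type*} [AddCommMonoid A] (ω : ℕ → A) (l : List ℕ) : A := (l.map ω).sum

@[simp] theorem listWeight_nil {A : Type*} [AddCommMonoid A] (ω : ℕ → A) :
    listWeight ω [] = 0 := rfl

@[simp] theorem listWeight_cons {A : Type*} [AddCommMonoid A] (ω : ℕ → A) (i : ℕ) (l : List ℕ) :
    listWeight ω (i :: l) = ω i + listWeight ω l := by simp [listWeight]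

/-- The homogeneous component of the Grassmann algebra of weight `t`. -/
noncomputable def component (ω : ℕ → ℤ) (t : ℤ) : Submodule K (Grassmann K) :=
  Submodule.span K {f | ∃ l, listWeight ω l = t ∧ mono K l = f}

variable {K}

/-- This is the relation required by the universal property of the exterior algebra, reduced to the
letters. The squares are assumed separately because anticommutation does not give them in
characteristic `2`. -/
theorem sq_linearCombination_eq_zero {A : Type*} [Ring A] [Algebra K A] (u : ℕ → A)
    (hs : ∀ i, u i * u i = 0) (hu : ∀ i j, u i * u j = -(u j * u i)) (m : ℕ →₀ K) :
    Finsupp.linearCombination K u m * Finsupp.linearCombination K u m = 0 := by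
  have h1 : ∀ (i : ℕ) (m : ℕ →₀ K), u i * Finsupp.linearCombination K u m =
      -(Finsupp.linearCombination K u m * u i) := by
    intro i m
    induction m using Finsupp.induction_linear with
    | zero => simp
    | add f g hf hg => rw [map_add, mul_add, hf, hg, add_mul, neg_add]
    | single j c => simp [hu i j]
  induction m using Finsupp.induction_linear with
  | zero => simp
  | add f g hf hg =>
    have h2 : Finsupp.linearCombination K u f * Finsupp.linearCombination K u g =
        -(Finsupp.linearCombination K u g * Finsupp.linearCombination K u f) := by
      clear hf hg
      induction f using Finsupp.induction_linear with
      | zero => simp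
      | add f f' hf hf' => rw [map_add, mul_add, add_mul, hf, hf', neg_add]
      | single j c => simp [h1 j g]
    rw [map_add, mul_add, add_mul, add_mul, hf, hg, h2]
    simp
  | single j c => simp [hs j]

/-- The coaction on the Grassmann algebra of the torus attached to a weight function. -/
noncomputable def coaction (ω : ℕ → ℤ) :
    Grassmann K →ₐ[K] AddMonoidAlgebra (Grassmann K) ℤ :=
  ExteriorAlgebra.lift K
    ⟨Finsupp.linearCombination K fun i => AddMonoidAlgebra.single (ω i) (gen K i), fun m =>
      sq_linearCombination_eq_zero _
        (fun i => by rw [AddMonoidAlgebra.single_mul_single, gen_mul_self,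
          AddMonoidAlgebra.single_zero])
        (fun i j => by rw [AddMonoidAlgebra.single_mul_single, AddMonoidAlgebra.single_mul_single,
          gen_mul_gen K i j, add_comm, AddMonoidAlgebra.single_neg]) m⟩

theorem coaction_mono (ω : ℕ → ℤ) (l : List ℕ) :
    coaction ω (mono K l) = AddMonoidAlgebra.single (listWeight ω l) (mono K l) := by
  induction l with
  | nil => simp
  | cons i l ih =>
    have h : coaction ω (gen K i) = AddMonoidAlgebra.single (ω i) (gen K i) := by
      refine (ExteriorAlgebra.lift_ι_apply K _ _ _).trans ?_
      rw [Finsupp.linearCombination_single, one_smul]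
    rw [mono_cons, map_mul, ih, h, AddMonoidAlgebra.single_mul_single, listWeight_cons]

/-- The projection of the Grassmann algebra onto the homogeneous component of weight `t`. -/
noncomputable def componentProj (ω : ℕ → ℤ) (t : ℤ) : Grassmann K →ₗ[K] Grassmann K where
  toFun f := (coaction ω f).coeff t
  map_add' f g := by simp
  map_smul' c f := by simp

theorem componentProj_mono (ω : ℕ → ℤ) (t : ℤ) (l : List ℕ) :
    componentProj ω t (mono K l) = if listWeight ω l = t then mono K l else 0 := by
  change (coaction ω (mono K l)).coeff t = _
  rw [coaction_mono, AddMonoidAlgebra.coeff_single, Finsupp.single_apply]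

theorem componentProj_of_mem {ω : ℕ → ℤ} {t : ℤ} {f : Grassmann K} (hf : f ∈ component K ω t)
    (s : ℤ) : componentProj ω s f = if t = s then f else 0 := by
  induction hf using Submodule.span_induction with
  | mem f hf => obtain ⟨l, rfl, rfl⟩ := hf; exact componentProj_mono ω s l
  | zero => simp
  | add f g _ _ hf hg => rw [map_add, hf, hg]; split_ifs <;> simp
  | smul c f _ hf => rw [map_smul, hf]; split_ifs <;> simp

theorem iSupIndep_component (ω : ℕ → ℤ) : iSupIndep (component K ω) := by
  intro t
  rw [Submodule.disjoint_def]
  intro f hf hf'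
  have h : (⨆ j, ⨆ (_ : j ≠ t), component K ω j) ≤ LinearMap.ker (componentProj ω t) :=
    iSup₂_le fun j hj g hg => by
      rw [LinearMap.mem_ker, componentProj_of_mem hg, if_neg hj]
  have h1 := h hf'
  rwa [LinearMap.mem_ker, componentProj_of_mem hf, if_pos rfl] at h1

variable (K)

/-- Operators that shift the weight `ω` by `s`. -/
def shift (ω : ℕ → ℤ) (s : ℤ) : Submodule K (Module.End K (Grassmann K)) where
  carrier := {w | ∀ t, ∀ f ∈ component K ω t, w f ∈ component K ω (s + t)}
  add_mem' ha hb t f hf := add_mem (ha t f hf) (hb t f hf)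
  zero_mem' _ _ _ := zero_mem _
  smul_mem' c _ ha t f hf := Submodule.smul_mem _ c (ha t f hf)

variable {K}

theorem mono_mem_component (ω : ℕ → ℤ) (l : List ℕ) :
    mono K l ∈ component K ω (listWeight ω l) := Submodule.subset_span ⟨l, rfl, rfl⟩

theorem mem_shift_of_mono {ω : ℕ → ℤ} {s : ℤ} {w : Module.End K (Grassmann K)}
    (h : ∀ l, w (mono K l) ∈ component K ω (s + listWeight ω l)) : w ∈ shift K ω s := by
  intro t f hf
  induction hf using Submodule.span_induction with
  | mem f hf => obtain ⟨l, rfl, rfl⟩ := hf; exact h l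
  | zero => simp
  | add f g _ _ hf hg => rw [map_add]; exact add_mem hf hg
  | smul c f _ hf => rw [map_smul]; exact Submodule.smul_mem _ c hf

theorem mul_mem_shift {ω : ℕ → ℤ} {s t : ℤ} {w u : Module.End K (Grassmann K)}
    (hw : w ∈ shift K ω s) (hu : u ∈ shift K ω t) : w * u ∈ shift K ω (s + t) := by
  intro r f hf
  rw [add_assoc]
  exact hw _ _ (hu _ _ hf)

theorem one_mem_shift (ω : ℕ → ℤ) : (1 : Module.End K (Grassmann K)) ∈ shift K ω 0 := by
  intro r f hf
  rwa [zero_add]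

theorem iSupIndep_shift (ω : ℕ → ℤ) : iSupIndep (shift K ω) := by
  intro s
  rw [Submodule.disjoint_def]
  intro w hw hw'
  refine linearMap_ext_mono K fun l => ?_
  have h : (⨆ j, ⨆ (_ : j ≠ s), shift K ω j) ≤
      LinearMap.ker (componentProj ω (s + listWeight ω l) ∘ₗ LinearMap.applyₗ (mono K l)) :=
    iSup₂_le fun j hj u hu => by
      have := hu _ _ (mono_mem_component ω l)
      simp only [LinearMap.mem_ker, LinearMap.comp_apply, LinearMap.applyₗ_apply_apply]
      rw [componentProj_of_mem this, if_neg (by simpa using hj)]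
  have h1 := h hw'
  simp only [LinearMap.mem_ker, LinearMap.comp_apply, LinearMap.applyₗ_apply_apply] at h1
  rwa [componentProj_of_mem (hw _ _ (mono_mem_component ω l)), if_pos rfl] at h1

/-- For independent components, an element of one component lying in the span of a set of
homogeneous elements lies in the span of those of them that lie in the component. -/
theorem mem_span_inter_of_iSupIndep {ι M : Type*} [AddCommGroup M] [Module K M]
    {E : ι → Submodule K M} (hE : iSupIndep E) {G : Set M} (hG : ∀ g ∈ G, ∃ s, g ∈ E s)
    {s : ι} {a : M} (ha : a ∈ Submodule.span K G) (has : a ∈ E s) :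
    a ∈ Submodule.span K (G ∩ E s) := by
  -- Generators outside `E s` contribute a part `c` lying in the sum of the other components; being
  -- a difference of two elements of `E s`, it also lies in `E s`, so it vanishes.
  rw [← Set.inter_union_sdiff G (E s), Submodule.span_union, Submodule.mem_sup] at ha
  obtain ⟨b, hb, c, hc, rfl⟩ := ha
  have hbs : b ∈ E s := Submodule.span_le.2 Set.inter_subset_right hb
  have hcs : c ∈ E s := by simpa using sub_mem has hbs
  have hc' : c ∈ ⨆ t, ⨆ (_ : t ≠ s), E t := by
    refine Submodule.span_le.2 ?_ hc
    rintro g ⟨hg, hgs⟩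
    obtain ⟨t, ht⟩ := hG g hg
    have hts : t ≠ s := by rintro rfl; exact hgs ht
    exact Submodule.mem_iSup_of_mem t (Submodule.mem_iSup_of_mem hts ht)
  rw [Submodule.disjoint_def.1 (hE s) c hcs hc', add_zero]
  exact hb

end Weights

/-! ### Superweight, parity and the supercommutator. -/

section Superweight

variable {K : Type*} [Field K]

/-- The superweight of the letter `x_i`. -/
def letterSwt (i : ℕ) : ℤ := -(-1) ^ i

theorem letterSwt_add_two (i : ℕ) : letterSwt (i + 2) = letterSwt i := by
  simp [letterSwt, pow_succ]

theorem letterSwt_succ (i : ℕ) : letterSwt (i + 1) = -letterSwt i := by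
  simp [letterSwt, pow_succ]

theorem letterSwt_eq_or (i : ℕ) : letterSwt i = 1 ∨ letterSwt i = -1 := by
  rcases neg_one_pow_eq_or ℤ i with h | h <;> simp [letterSwt, h]

theorem letterSwt_cast (i : ℕ) : ((letterSwt i : ℤ) : ZMod 2) = 1 := by
  rcases letterSwt_eq_or i with h | h <;> rw [h] <;> decide

theorem listWeight_letterSwt_cast (l : List ℕ) :
    ((listWeight letterSwt l : ℤ) : ZMod 2) = l.length := by
  induction l with
  | nil => simp
  | cons i l ih =>
    rw [listWeight_cons, Int.cast_add, ih, letterSwt_cast, List.length_cons, Nat.cast_succ,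
      add_comm]

theorem gen_mem_parity (i : ℕ) : gen K i ∈ parity K 1 :=
  CliffordAlgebra.ι_mem_evenOdd_one _ _

theorem mono_mem_parity (l : List ℕ) : mono K l ∈ parity K (l.length : ZMod 2) := by
  induction l with
  | nil => exact CliffordAlgebra.one_le_evenOdd_zero _ (Submodule.one_le.1 le_rfl)
  | cons i l ih =>
    rw [mono_cons, List.length_cons, Nat.cast_succ, add_comm]
    exact CliffordAlgebra.evenOdd_mul_le _ _ _ (Submodule.mul_mem_mul (gen_mem_parity i) ih)

theorem iSupIndep_parity : iSupIndep (parity K) :=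
  (DirectSum.Decomposition.isInternal (parity K)).submodule_iSupIndep

theorem mem_parity_span {a : ZMod 2} {f : Grassmann K} (hf : f ∈ parity K a) :
    f ∈ Submodule.span K {g | ∃ l : List ℕ, (l.length : ZMod 2) = a ∧ mono K l = g} := by
  have h := mem_span_inter_of_iSupIndep (K := K) (E := parity K) iSupIndep_parity
    -- A product of letters that vanishes lies in both parity components whatever its length, so
    -- zero is removed from the generators.
    (G := {g | g ≠ 0 ∧ ∃ l, mono K l = g})
    (by rintro _ ⟨-, l, rfl⟩; exact ⟨_, mono_mem_parity l⟩) (s := a) (a := f) (by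
      have h1 : f ∈ Submodule.span K (Set.range (mono K)) := span_mono_eq_top K ▸ trivial
      rw [← Submodule.span_sdiff_singleton_zero] at h1
      refine Submodule.span_mono ?_ h1
      rintro _ ⟨⟨l, rfl⟩, h0⟩
      exact ⟨h0, l, rfl⟩) hf
  refine Submodule.span_mono ?_ h
  rintro _ ⟨⟨h0, l, rfl⟩, hl⟩
  refine ⟨l, ?_, rfl⟩
  by_contra hne
  exact h0 (Submodule.disjoint_def.1 (iSupIndep_parity.pairwiseDisjoint hne) _
    (mono_mem_parity l) hl)

theorem component_le_parity (t : ℤ) : component K letterSwt t ≤ parity K (t : ZMod 2) := by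
  refine Submodule.span_le.2 ?_
  rintro _ ⟨l, rfl, rfl⟩
  rw [listWeight_letterSwt_cast]
  exact mono_mem_parity l

variable (K)

/-- The operators of parity `a`. -/
def opParity (a : ZMod 2) : Submodule K (Module.End K (Grassmann K)) where
  carrier := {w | ∀ b, ∀ f ∈ parity K b, w f ∈ parity K (a + b)}
  add_mem' ha hb t f hf := add_mem (ha t f hf) (hb t f hf)
  zero_mem' _ _ _ := zero_mem _
  smul_mem' c _ ha t f hf := Submodule.smul_mem _ c (ha t f hf)

variable {K}

/-- Every letter has superweight `1` or `-1`, so superweight modulo `2` is parity. Homogeneity in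
superweight therefore fixes the sign in the supercommutator. -/
theorem shift_le_opParity (s : ℤ) : shift K letterSwt s ≤ opParity K (s : ZMod 2) := by
  intro w hw b f hf
  replace hf := mem_parity_span hf
  induction hf using Submodule.span_induction with
  | mem f hf =>
    obtain ⟨l, rfl, rfl⟩ := hf
    rw [← listWeight_letterSwt_cast, ← Int.cast_add]
    exact component_le_parity _ (hw _ _ (mono_mem_component _ l))
  | zero => simp
  | add f g _ _ hf hg => rw [map_add]; exact add_mem hf hg
  | smul c f _ hf => rw [map_smul]; exact Submodule.smul_mem _ c hf

theorem iSupIndep_opParity : iSupIndep (opParity K) := by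
  intro s
  rw [Submodule.disjoint_def]
  intro w hw hw'
  refine linearMap_ext_mono K fun l => ?_
  have h : (⨆ j, ⨆ (_ : j ≠ s), opParity K j) ≤
      (⨆ j, ⨆ (_ : j ≠ s + l.length), parity K j).comap (LinearMap.applyₗ (mono K l)) :=
    iSup₂_le fun j hj u hu => by
      refine Submodule.mem_iSup_of_mem (j + l.length)
        (Submodule.mem_iSup_of_mem (by simpa using hj) (hu _ _ (mono_mem_parity l)))
  exact Submodule.disjoint_def.1 (iSupIndep_parity _) _ (hw _ _ (mono_mem_parity l)) (h hw')

theorem parityPart_of_mem {c : ZMod 2} {φ : Module.End K (Grassmann K)} (hφ : φ ∈ opParity K c)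
    (a : ZMod 2) : parityPart a φ = if a = c then φ else 0 := by
  have key : ∀ b f, GradedAlgebra.proj (parity K) (a + b) (φ (GradedAlgebra.proj (parity K) b f)) =
      if a = c then φ (GradedAlgebra.proj (parity K) b f) else 0 := by
    intro b f
    have h1 : φ (GradedAlgebra.proj (parity K) b f) ∈ parity K (c + b) :=
      hφ _ _ (by rw [GradedAlgebra.proj_apply]; exact SetLike.coe_mem _)
    rw [GradedAlgebra.proj_apply (parity K) (a + b)]
    split_ifs with h
    · subst h; exact DirectSum.decompose_of_mem_same _ h1
    · exact DirectSum.decompose_of_mem_ne _ h1 (by simpa using Ne.symm h)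
  refine LinearMap.ext fun f => ?_
  simp only [parityPart, LinearMap.sum_apply, LinearMap.comp_apply, key]
  split_ifs with h
  · classical
    rw [← map_sum]
    congr 1
    have := DirectSum.sum_support_decompose (parity K) f
    simp only [GradedAlgebra.proj_apply]
    rw [← this]
    conv_lhs => rw [this]
    exact (Finset.sum_subset (Finset.subset_univ _) (by intro i _ hi; simpa using hi)).symm
  · simp

theorem superBracket_of_mem {c d : ZMod 2} {φ ψ : Module.End K (Grassmann K)}
    (hφ : φ ∈ opParity K c) (hψ : ψ ∈ opParity K d) :
    superBracket φ ψ = φ * ψ - (-1 : K) ^ (c.val * d.val) • (ψ * φ) := by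
  unfold superBracket
  rw [Finset.sum_eq_single c, Finset.sum_eq_single d]
  · rw [parityPart_of_mem hφ, parityPart_of_mem hψ, if_pos rfl, if_pos rfl]
  · intro b _ hb
    rw [parityPart_of_mem hψ, if_neg hb]; simp
  · simp
  · intro b _ hb
    rw [parityPart_of_mem hφ, if_neg hb]; simp
  · simp

theorem superBracket_of_mem_shift {s t : ℤ} {φ ψ : Module.End K (Grassmann K)}
    (hφ : φ ∈ shift K letterSwt s) (hψ : ψ ∈ shift K letterSwt t) :
    superBracket φ ψ =
      φ * ψ - (-1 : K) ^ ((s : ZMod 2).val * (t : ZMod 2).val) • (ψ * φ) :=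
  superBracket_of_mem (shift_le_opParity s hφ) (shift_le_opParity t hψ)

theorem superBracket_mem_shift {s t : ℤ} {φ ψ : Module.End K (Grassmann K)}
    (hφ : φ ∈ shift K letterSwt s) (hψ : ψ ∈ shift K letterSwt t) :
    superBracket φ ψ ∈ shift K letterSwt (s + t) := by
  rw [superBracket_of_mem_shift hφ hψ]
  exact sub_mem (mul_mem_shift hφ hψ)
    (Submodule.smul_mem _ _ (add_comm t s ▸ mul_mem_shift hψ hφ))

theorem parityPart_add (a : ZMod 2) (φ ψ : Module.End K (Grassmann K)) :
    parityPart a (φ + ψ) = parityPart a φ + parityPart a ψ := by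
  simp [parityPart, LinearMap.add_comp, LinearMap.comp_add, Finset.sum_add_distrib]

theorem parityPart_smul (a : ZMod 2) (c : K) (φ : Module.End K (Grassmann K)) :
    parityPart a (c • φ) = c • parityPart a φ := by
  simp [parityPart, LinearMap.smul_comp, LinearMap.comp_smul, Finset.smul_sum]

variable (K)

/-- The supercommutator as a bilinear mapping. -/
noncomputable def superBracketBilin :
    Module.End K (Grassmann K) →ₗ[K] Module.End K (Grassmann K) →ₗ[K]
      Module.End K (Grassmann K) :=
  LinearMap.mk₂ K superBracket
    (fun φ φ' ψ => by
      simp only [superBracket, parityPart_add, ← Finset.sum_add_distrib]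
      refine Finset.sum_congr rfl fun a _ => Finset.sum_congr rfl fun b _ => ?_
      rw [add_mul, mul_add, smul_add]; abel)
    (fun c φ ψ => by
      simp only [superBracket, parityPart_smul, Finset.smul_sum]
      refine Finset.sum_congr rfl fun a _ => Finset.sum_congr rfl fun b _ => ?_
      rw [smul_mul_assoc, mul_smul_comm, smul_sub, smul_comm c])
    (fun φ ψ ψ' => by
      simp only [superBracket, parityPart_add, ← Finset.sum_add_distrib]
      refine Finset.sum_congr rfl fun a _ => Finset.sum_congr rfl fun b _ => ?_
      rw [add_mul, mul_add, smul_add]; abel)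
    (fun c φ ψ => by
      simp only [superBracket, parityPart_smul, Finset.smul_sum]
      refine Finset.sum_congr rfl fun a _ => Finset.sum_congr rfl fun b _ => ?_
      rw [smul_mul_assoc, mul_smul_comm, smul_sub, smul_comm c])

variable {K}

theorem superBracket_mem_of_span {G H : Set (Module.End K (Grassmann K))}
    {B : Submodule K (Module.End K (Grassmann K))}
    (h : ∀ g ∈ G, ∀ h ∈ H, superBracket g h ∈ B) {x y : Module.End K (Grassmann K)}
    (hx : x ∈ Submodule.span K G) (hy : y ∈ Submodule.span K H) : superBracket x y ∈ B := by
  have h1 : Submodule.map₂ (superBracketBilin K) (Submodule.span K G) (Submodule.span K H) ≤ B := by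
    rw [Submodule.map₂_span_span, Submodule.span_le]
    rintro _ ⟨g, hg, k, hk, rfl⟩
    exact h g hg k hk
  exact h1 (Submodule.apply_mem_map₂ (superBracketBilin K) hx hy)

/-- An odd element of the span of homogeneous operators is a combination of odd ones. -/
theorem mem_span_odd {G : Set (Module.End K (Grassmann K))}
    (hG : ∀ g ∈ G, ∃ s, g ∈ shift K letterSwt s) {x : Module.End K (Grassmann K)}
    (hx : x ∈ Submodule.span K G) (hodd : IsOdd x) :
    x ∈ Submodule.span K (G ∩ opParity K 1) :=
  mem_span_inter_of_iSupIndep iSupIndep_opParity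
    (fun g hg => (hG g hg).elim fun _ hs => ⟨_, shift_le_opParity _ hs⟩) hx hodd

/-- The square of an odd combination of homogeneous operators lies in any submodule that contains
the supercommutators and the squares of the odd operators among them. -/
theorem sq_mem_of_span {G : Set (Module.End K (Grassmann K))}
    (hG : ∀ g ∈ G, ∃ s, g ∈ shift K letterSwt s) {B : Submodule K (Module.End K (Grassmann K))}
    (hb : ∀ g ∈ G, ∀ h ∈ G, superBracket g h ∈ B)
    (hs : ∀ g ∈ G, IsOdd g → g * g ∈ B) {x : Module.End K (Grassmann K)}
    (hx : x ∈ Submodule.span K G) (hodd : IsOdd x) : x * x ∈ B := by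
  have h := mem_span_odd hG hx hodd
  have h1 : Submodule.span K (G ∩ opParity K 1) ≤ opParity K 1 :=
    Submodule.span_le.2 Set.inter_subset_right
  have h2 : Submodule.span K (G ∩ opParity K 1) ≤ Submodule.span K G :=
    Submodule.span_mono Set.inter_subset_left
  clear hx hodd
  induction h using Submodule.span_induction with
  | mem f hf => exact hs f hf.1 hf.2
  | zero => simp
  | add f g hf' hg' hf hg =>
    have h3 : superBracket f g ∈ B := superBracket_mem_of_span hb (h2 hf') (h2 hg')
    rw [superBracket_of_mem (h1 hf') (h1 hg')] at h3
    -- Polarization: for odd `f` and `g` the mixed terms of the square form their supercommutator.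
    have h4 : (f + g) * (f + g) =
        f * f + g * g + (f * g - (-1 : K) ^ ((1 : ZMod 2).val * (1 : ZMod 2).val) • (g * f)) := by
      rw [show (1 : ZMod 2).val * (1 : ZMod 2).val = 1 from rfl, pow_one,
        show (-1 : K) • (g * f) = -(g * f) from neg_one_smul K (g * f)]
      noncomm_ring
    rw [h4]
    exact add_mem (add_mem hf hg) h3
  | smul c f _ hf =>
    rw [smul_mul_smul_comm]
    exact Submodule.smul_mem _ _ hf

theorem isLieSuperSubalgebra_span {G : Set (Module.End K (Grassmann K))}
    (hG : ∀ g ∈ G, ∃ s, g ∈ shift K letterSwt s)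
    (hb : ∀ g ∈ G, ∀ h ∈ G, superBracket g h ∈ Submodule.span K G)
    (hs : ∀ g ∈ G, IsOdd g → g * g ∈ Submodule.span K G) :
    IsLieSuperSubalgebra (Submodule.span K G) :=
  ⟨fun _ hx _ hy => superBracket_mem_of_span hb hx hy,
    fun _ hx hodd => sq_mem_of_span hG hb hs hx hodd⟩

end Superweight

/-! ### The pivot elements: recursion, Leibniz rule and superweight. -/

section Pivot

variable {K : Type*} [Field K]

theorem gen_mul_gen_mul (i j : ℕ) (f : Grassmann K) :
    gen K i * (gen K j * f) = -(gen K j * (gen K i * f)) := by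
  rw [← mul_assoc, gen_mul_gen, neg_mul, mul_assoc]

theorem gen_mul_gen_mul_self (i : ℕ) (f : Grassmann K) : gen K i * (gen K i * f) = 0 := by
  rw [← mul_assoc, gen_mul_self, zero_mul]

theorem gen_pair_comm (i j k : ℕ) (f : Grassmann K) :
    gen K i * (gen K j * (gen K k * f)) = gen K k * (gen K i * (gen K j * f)) := by
  rw [gen_mul_gen_mul j k, mul_neg, gen_mul_gen_mul i k, neg_neg]

theorem partialD_gen_mul_of_ne {i j : ℕ} (h : i ≠ j) (f : Grassmann K) :
    partialD K i (gen K j * f) = -(gen K j * partialD K i f) := by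
  rw [partialD_gen_mul, if_neg h, zero_smul, zero_sub]

theorem partialD_gen_mul_self (i : ℕ) (f : Grassmann K) :
    partialD K i (gen K i * f) = f - gen K i * partialD K i f := by
  rw [partialD_gen_mul, if_pos rfl, one_smul]

theorem pivotTerm_zero (i : ℕ) : pivotTerm K i 0 = partialD K i := by rw [pivotTerm]

theorem pivotTerm_succ_apply (i k : ℕ) (f : Grassmann K) :
    pivotTerm K i (k + 1) f = gen K i * (gen K (i + 1) * pivotTerm K (i + 2) k f) := by
  rw [pivotTerm]; rfl

theorem pivot_apply_eq_sum (i : ℕ) {N : ℕ} {f : Grassmann K}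
    (h : ∀ j, N ≤ j → partialD K j f = 0) :
    pivot K i f = ∑ k ∈ Finset.range N, pivotTerm K i k f := by
  change ∑ᶠ k, pivotTerm K i k f = _
  refine finsum_eq_sum_of_support_subset _ fun k hk => ?_
  rw [Finset.coe_range, Set.mem_Iio]
  by_contra hN
  exact hk (pivotTerm_apply_eq_zero K k i f (h _ (by omega)))

/-- Splitting off the first term of the series leaves the series for index `i + 2`; this recursion
drives the reduction of words. -/
theorem pivot_apply (i : ℕ) (f : Grassmann K) :
    pivot K i f = partialD K i f + gen K i * (gen K (i + 1) * pivot K (i + 2) f) := by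
  obtain ⟨N, hN⟩ := partialD_eventually_zero K f
  rw [pivot_apply_eq_sum i (N := N + 1) fun j hj => hN j (by omega), pivot_apply_eq_sum (i + 2) hN,
    Finset.sum_range_succ', pivotTerm_zero, add_comm, Finset.mul_sum, Finset.mul_sum]
  simp only [pivotTerm_succ_apply]

theorem pivot_one (i : ℕ) : pivot K i 1 = 0 := by
  rw [pivot_apply_eq_sum i (N := 0) fun j _ => partialD_one K j, Finset.sum_range_zero]

/-- The pair `x_i x_{i+1}` is even, so it passes any letter without a sign and the Leibniz rule of
`∂` survives each layer. -/
theorem pivotTerm_gen_mul (k : ℕ) : ∀ (i j : ℕ) (f : Grassmann K),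
    pivotTerm K i k (gen K j * f) =
      pivotTerm K i k (gen K j) * f - gen K j * pivotTerm K i k f := by
  induction k with
  | zero =>
    intro i j f
    rw [pivotTerm_zero, partialD_gen_mul, partialD_gen, smul_mul_assoc, one_mul]
  | succ k ih =>
    intro i j f
    rw [pivotTerm_succ_apply, ih, pivotTerm_succ_apply, pivotTerm_succ_apply, mul_sub, mul_sub,
      gen_pair_comm i (i + 1) j]
    simp only [mul_assoc]

theorem exists_pivot_eq_sum (i : ℕ) (f g : Grassmann K) :
    ∃ N, pivot K i f = ∑ k ∈ Finset.range N, pivotTerm K i k f ∧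
      pivot K i g = ∑ k ∈ Finset.range N, pivotTerm K i k g := by
  obtain ⟨N, hN⟩ := partialD_eventually_zero K f
  obtain ⟨M, hM⟩ := partialD_eventually_zero K g
  exact ⟨max N M, pivot_apply_eq_sum i fun j hj => hN j (le_trans (le_max_left _ _) hj),
    pivot_apply_eq_sum i fun j hj => hM j (le_trans (le_max_right _ _) hj)⟩

theorem pivot_gen_mul (i j : ℕ) (f : Grassmann K) :
    pivot K i (gen K j * f) = pivot K i (gen K j) * f - gen K j * pivot K i f := by
  obtain ⟨N₀, hN₀⟩ := partialD_eventually_zero K (gen K j * f)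
  obtain ⟨N₁, hN₁⟩ := partialD_eventually_zero K (gen K j)
  obtain ⟨N₂, hN₂⟩ := partialD_eventually_zero K f
  rw [pivot_apply_eq_sum i (N := N₀ + N₁ + N₂) fun k hk => hN₀ k (by omega),
    pivot_apply_eq_sum i (N := N₀ + N₁ + N₂) fun k hk => hN₁ k (by omega),
    pivot_apply_eq_sum i (N := N₀ + N₁ + N₂) fun k hk => hN₂ k (by omega),
    Finset.sum_mul, Finset.mul_sum, ← Finset.sum_sub_distrib]
  exact Finset.sum_congr rfl fun k _ => pivotTerm_gen_mul k i j f

theorem pivotTerm_gen_of_lt (k : ℕ) {i j : ℕ} (h : j < i) : pivotTerm K i k (gen K j) = 0 :=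
  pivotTerm_apply_eq_zero K k i _ (by rw [partialD_gen, if_neg (by omega), zero_smul])

theorem pivot_gen_of_lt {i j : ℕ} (h : j < i) : pivot K i (gen K j) = 0 := by
  rw [pivot_apply_eq_sum i (N := j + 1) fun k hk => by
    rw [partialD_gen, if_neg (by omega), zero_smul]]
  exact Finset.sum_eq_zero fun k _ => pivotTerm_gen_of_lt k h

theorem pivot_gen_mul_of_lt {i j : ℕ} (h : j < i) (f : Grassmann K) :
    pivot K i (gen K j * f) = -(gen K j * pivot K i f) := by
  rw [pivot_gen_mul, pivot_gen_of_lt h, zero_mul, zero_sub]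

/-- Only letters and derivatives of index at least `i` occur in the term; `∂_j` anticommutes with
each, and their number is odd. -/
theorem pivotTerm_partialD (k : ℕ) : ∀ {i j : ℕ} (_ : j < i) (f : Grassmann K),
    pivotTerm K i k (partialD K j f) = -partialD K j (pivotTerm K i k f) := by
  induction k with
  | zero => intro i j _ f; rw [pivotTerm_zero, partialD_comm]
  | succ k ih =>
    intro i j h f
    rw [pivotTerm_succ_apply, pivotTerm_succ_apply, ih (by omega), partialD_gen_mul_of_ne (by omega),
      partialD_gen_mul_of_ne (by omega)]
    simp only [mul_neg, neg_neg]

theorem pivot_partialD {i j : ℕ} (h : j < i) (f : Grassmann K) :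
    pivot K i (partialD K j f) = -partialD K j (pivot K i f) := by
  obtain ⟨N, h1, h2⟩ := exists_pivot_eq_sum i (partialD K j f) f
  rw [h1, h2, map_sum, ← Finset.sum_neg_distrib]
  exact Finset.sum_congr rfl fun k _ => pivotTerm_partialD k h f

theorem letter_mem_shift (i : ℕ) : letter K i ∈ shift K letterSwt (letterSwt i) :=
  mem_shift_of_mono fun l => by
    rw [letter_apply, ← mono_cons, ← listWeight_cons]
    exact mono_mem_component _ _

theorem partialD_mem_shift (i : ℕ) : partialD K i ∈ shift K letterSwt (-letterSwt i) :=
  mem_shift_of_mono fun l => by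
    induction l with
    | nil => rw [mono_nil, partialD_one]; exact zero_mem _
    | cons j l ih =>
      rw [mono_cons, partialD_gen_mul, listWeight_cons]
      refine sub_mem ?_ ?_
      · split_ifs with h
        · subst h
          rw [one_smul, neg_add_cancel_left]
          exact mono_mem_component _ _
        · rw [zero_smul]; exact zero_mem _
      · rw [add_left_comm]
        exact letter_mem_shift j _ _ ih

/-- The pair `x_i x_{i+1}` has superweight zero and indices move by two, so all summands of `v_i`
share the superweight of `∂_i`. -/
theorem pivotTerm_mem_shift (k : ℕ) : ∀ i, pivotTerm K i k ∈ shift K letterSwt (-letterSwt i) := by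
  induction k with
  | zero => intro i; rw [pivotTerm_zero]; exact partialD_mem_shift i
  | succ k ih =>
    intro i
    rw [pivotTerm]
    have h := mul_mem_shift (mul_mem_shift (letter_mem_shift (K := K) i) (letter_mem_shift (i + 1)))
      (ih (i + 2))
    rwa [letterSwt_succ, letterSwt_add_two, add_neg_cancel, zero_add] at h

theorem pivot_mem_shift (i : ℕ) : pivot K i ∈ shift K letterSwt (-letterSwt i) := by
  intro t f hf
  obtain ⟨N, hN⟩ := partialD_eventually_zero K f
  rw [pivot_apply_eq_sum i hN]
  exact Submodule.sum_mem _ fun k _ => pivotTerm_mem_shift k i t f hf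

theorem IsMonomial.mem_shift {s : ℤ} {w : Module.End K (Grassmann K)} (h : IsMonomial s w) :
    w ∈ shift K letterSwt s := by
  induction h with
  | letter i => exact letter_mem_shift i
  | partialD i => simpa [letterSwt] using partialD_mem_shift (K := K) i
  | pivot i => simpa [letterSwt] using pivot_mem_shift (K := K) i
  | mul _ _ h1 h2 => exact mul_mem_shift h1 h2
  | bracket _ _ h1 h2 => exact superBracket_mem_shift h1 h2

end Pivot

/-! ### Elements of `lieR` as triangular superderivations. -/

section Derivations

variable (K : Type*) [Field K]

/-- The subspace spanned by the products of the letters `x_i` with `i < n`. -/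
noncomputable def below (n : ℕ) : Submodule K (Grassmann K) :=
  Submodule.span K {f | ∃ l : List ℕ, (∀ i ∈ l, i < n) ∧ mono K l = f}

variable {K}

theorem one_mem_below (n : ℕ) : (1 : Grassmann K) ∈ below K n :=
  Submodule.subset_span ⟨[], by simp, rfl⟩

theorem gen_mem_below {i n : ℕ} (h : i < n) : gen K i ∈ below K n :=
  Submodule.subset_span ⟨[i], by simpa using h, by simp [mono]⟩

theorem below_mono {m n : ℕ} (h : m ≤ n) : below K m ≤ below K n :=
  Submodule.span_mono fun _ ⟨l, hl, hf⟩ => ⟨l, fun i hi => (hl i hi).trans_le h, hf⟩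

theorem mul_mem_below {n : ℕ} {f g : Grassmann K} (hf : f ∈ below K n) (hg : g ∈ below K n) :
    f * g ∈ below K n := by
  have h := Submodule.mul_mem_mul hf hg
  unfold below at h
  rw [Submodule.span_mul_span] at h
  refine Submodule.span_mono ?_ h
  rintro _ ⟨_, ⟨l, hl, rfl⟩, _, ⟨m, hm, rfl⟩, rfl⟩
  refine ⟨l ++ m, fun i hi => ?_, mono_append K l m⟩
  rcases List.mem_append.1 hi with h | h
  exacts [hl i h, hm i h]

theorem pivotTerm_gen_mem_below (k : ℕ) : ∀ i j, pivotTerm K i k (gen K j) ∈ below K j := by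
  induction k with
  | zero =>
    intro i j
    rw [pivotTerm_zero, partialD_gen]
    exact Submodule.smul_mem _ _ (one_mem_below j)
  | succ k ih =>
    intro i j
    rw [pivotTerm_succ_apply]
    by_cases h : j < i + 2
    · rw [pivotTerm_gen_of_lt k h, mul_zero, mul_zero]; exact zero_mem _
    · exact mul_mem_below (gen_mem_below (by omega))
        (mul_mem_below (gen_mem_below (by omega)) (ih _ _))

theorem pivot_gen_mem_below (i j : ℕ) : pivot K i (gen K j) ∈ below K j := by
  obtain ⟨N, hN⟩ := partialD_eventually_zero K (gen K j)
  rw [pivot_apply_eq_sum i hN]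
  exact Submodule.sum_mem _ fun k _ => pivotTerm_gen_mem_below k i j

variable (K)

/-- The triangular superderivations of parity `a`: those that map every letter `x_j` to a
combination of products of letters `x_i` with `i < j`. -/
noncomputable def triangularDer (a : ZMod 2) : Submodule K (Module.End K (Grassmann K)) where
  carrier := {D | (∀ b, ∀ g ∈ parity K b, ∀ f,
      D (g * f) = D g * f + (-1 : K) ^ (a.val * b.val) • (g * D f)) ∧
    ∀ j, D (gen K j) ∈ below K j}
  add_mem' := by
    rintro D D' ⟨h1, h2⟩ ⟨h1', h2'⟩
    refine ⟨fun b g hg f => ?_, fun j => add_mem (h2 j) (h2' j)⟩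
    simp only [LinearMap.add_apply]
    rw [h1 b g hg, h1' b g hg, mul_add, add_mul, smul_add]
    abel
  zero_mem' := ⟨fun _ _ _ _ => by simp, fun _ => zero_mem _⟩
  smul_mem' := by
    rintro c D ⟨h1, h2⟩
    refine ⟨fun b g hg f => ?_, fun j => Submodule.smul_mem _ c (h2 j)⟩
    simp only [LinearMap.smul_apply]
    rw [h1 b g hg, mul_smul_comm, smul_mul_assoc, smul_add, smul_comm c]

variable {K}

theorem triangularDer_one {a : ZMod 2} {D : Module.End K (Grassmann K)}
    (hD : D ∈ triangularDer K a) : D 1 = 0 := by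
  have h := hD.1 0 1 (mono_mem_parity (K := K) []) 1
  simpa using h

theorem triangularDer_mem_below {a : ZMod 2} {D : Module.End K (Grassmann K)}
    (hD : D ∈ triangularDer K a) {n : ℕ} {f : Grassmann K} (hf : f ∈ below K n) :
    D f ∈ below K n := by
  induction hf using Submodule.span_induction with
  | mem f hf =>
    obtain ⟨l, hl, rfl⟩ := hf
    induction l with
    | nil => rw [mono_nil, triangularDer_one hD]; exact zero_mem _
    | cons i l ih =>
      have hi : i < n := hl i (by simp)
      have hl' : ∀ i ∈ l, i < n := fun j hj => hl j (by simp [hj])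
      rw [mono_cons, hD.1 1 _ (gen_mem_parity i)]
      exact add_mem (mul_mem_below (below_mono hi.le (hD.2 i)) (Submodule.subset_span ⟨l, hl', rfl⟩))
        (Submodule.smul_mem _ _ (mul_mem_below (gen_mem_below hi) (ih hl')))
  | zero => simp
  | add f g _ _ hf hg => rw [map_add]; exact add_mem hf hg
  | smul c f _ hf => rw [map_smul]; exact Submodule.smul_mem _ c hf

/-- Moving an odd operator past one letter costs one sign, so past a product of letters it costs the
parity of the length. -/
theorem mem_triangularDer_one {D : Module.End K (Grassmann K)}
    (h : ∀ i f, D (gen K i * f) = D (gen K i) * f - gen K i * D f) (h1 : D 1 = 0)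
    (hb : ∀ j, D (gen K j) ∈ below K j) : D ∈ triangularDer K 1 := by
  refine ⟨fun b g hg f => ?_, hb⟩
  replace hg := mem_parity_span hg
  have key : ∀ l : List ℕ,
      D (mono K l * f) = D (mono K l) * f + (-1 : K) ^ l.length • (mono K l * D f) := by
    intro l
    induction l with
    | nil => simp [h1]
    | cons i l ih =>
      rw [mono_cons, mul_assoc, h, ih, h i (mono K l), List.length_cons, pow_succ, mul_neg, mul_one,
        mul_add, mul_smul_comm, sub_mul]
      simp only [mul_assoc]
      module
  induction hg using Submodule.span_induction with
  | mem g hg =>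
    obtain ⟨l, rfl, rfl⟩ := hg
    rw [key, show (1 : ZMod 2).val = 1 from rfl, one_mul, ZMod.val_natCast,
      ← neg_one_pow_eq_pow_mod_two]
  | zero => simp
  | add g g' _ _ hg hg' =>
    rw [add_mul, map_add, map_add, hg, hg', add_mul, add_mul]
    module
  | smul c g _ hg =>
    rw [smul_mul_assoc, map_smul, map_smul, hg, smul_mul_assoc, smul_mul_assoc]
    module

theorem pivot_mem_triangularDer (i : ℕ) : pivot K i ∈ triangularDer K 1 :=
  mem_triangularDer_one (pivot_gen_mul i) (pivot_one i) (pivot_gen_mem_below i)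

theorem sign_add_left (a b c : ZMod 2) : (-1 : K) ^ ((a + b).val * c.val) =
    (-1) ^ (a.val * c.val) * (-1) ^ (b.val * c.val) := by
  have h : ∀ a b c : ZMod 2, (-1 : ℤ) ^ ((a + b).val * c.val) =
    (-1) ^ (a.val * c.val) * (-1) ^ (b.val * c.val) := by decide
  exact_mod_cast congrArg (Int.cast : ℤ → K) (h a b c)

theorem sign_add_right (a b c : ZMod 2) : (-1 : K) ^ (a.val * (b + c).val) =
    (-1) ^ (a.val * b.val) * (-1) ^ (a.val * c.val) := by
  rw [mul_comm, sign_add_left, mul_comm a.val, mul_comm a.val]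

theorem bracket_mem_triangularDer {a b : ZMod 2} {D D' : Module.End K (Grassmann K)}
    (hD : D ∈ triangularDer K a) (hDa : D ∈ opParity K a) (hD' : D' ∈ triangularDer K b)
    (hDb : D' ∈ opParity K b) :
    D * D' - (-1 : K) ^ (a.val * b.val) • (D' * D) ∈ triangularDer K (a + b) := by
  refine ⟨fun c g hg f => ?_, fun j => sub_mem (triangularDer_mem_below hD (hD'.2 j))
    (Submodule.smul_mem _ _ (triangularDer_mem_below hD' (hD.2 j)))⟩
  simp only [LinearMap.sub_apply, LinearMap.smul_apply, Module.End.mul_apply]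
  rw [hD.1 c g hg, hD'.1 c g hg, map_add, map_add, map_smul, map_smul,
    hD.1 _ _ (hDb c g hg), hD.1 c g hg, hD'.1 _ _ (hDa c g hg), hD'.1 c g hg, sign_add_left,
    sign_add_right, sign_add_right, mul_comm b.val a.val, mul_sub, sub_mul, mul_smul_comm,
    smul_mul_assoc]
  have h : (-1 : K) ^ (a.val * b.val) * (-1) ^ (a.val * b.val) = 1 := by
    rw [← pow_add, ← two_mul, pow_mul]; simp
  -- The terms in `D' g * D f` cancel formally; those in `D g * D' f` cancel because the sign `(-1)
  -- ^ (ab)` squares to one.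
  linear_combination (norm := module) (-((-1 : K) ^ (b.val * c.val)) * h) • (D g * D' f)

/-- Moving `D` past `D g` instead of `g` costs one more sign, so the two mixed terms `D g * D f`
cancel without division by `2`. -/
theorem sq_mem_triangularDer {D : Module.End K (Grassmann K)}
    (hD : D ∈ triangularDer K 1) (hDa : D ∈ opParity K 1) : D * D ∈ triangularDer K 0 := by
  refine ⟨fun c g hg f => ?_, fun j => triangularDer_mem_below hD (hD.2 j)⟩
  simp only [Module.End.mul_apply]
  rw [hD.1 c g hg, map_add, map_smul, hD.1 _ _ (hDa c g hg), hD.1 c g hg, sign_add_right]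
  have h : (-1 : K) ^ ((1 : ZMod 2).val * c.val) * (-1) ^ ((1 : ZMod 2).val * c.val) = 1 := by
    rw [← pow_add, ← two_mul, pow_mul]; simp
  rw [smul_add, smul_smul, h]
  rw [show (1 : ZMod 2).val * (1 : ZMod 2).val = 1 from rfl, show (0 : ZMod 2).val = 0 from rfl,
    zero_mul, pow_zero]
  module

/-- Every element of `Lie(v_0, v_1)` is a combination of homogeneous triangular
superderivations. -/
theorem lieR_le_span_triangularDer : lieR K ≤ Submodule.span K
    {D | ∃ s : ℤ, D ∈ shift K letterSwt s ∧ D ∈ triangularDer K (s : ZMod 2)} := by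
  refine sInf_le ⟨isLieSuperSubalgebra_span (fun g ⟨s, hs, _⟩ => ⟨s, hs⟩) ?_ ?_, ?_⟩
  · rintro g ⟨s, hs, hs'⟩ h ⟨t, ht, ht'⟩
    refine Submodule.subset_span ⟨s + t, superBracket_mem_shift hs ht, ?_⟩
    rw [superBracket_of_mem_shift hs ht, Int.cast_add]
    exact bracket_mem_triangularDer hs' (shift_le_opParity s hs) ht' (shift_le_opParity t ht)
  · rintro g ⟨s, hs, hs'⟩ hodd
    -- An odd operator of even superweight lies in both parity components and is zero.
    by_cases h0 : (s : ZMod 2) = 1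
    · refine Submodule.subset_span ⟨s + s, mul_mem_shift hs hs, ?_⟩
      rw [h0] at hs'
      rw [Int.cast_add, h0]
      exact sq_mem_triangularDer hs' hodd
    · have : g = 0 := Submodule.disjoint_def.1 (iSupIndep_opParity.pairwiseDisjoint h0) g
        (shift_le_opParity s hs) hodd
      rw [this, mul_zero]
      exact zero_mem _
  · have h : ∀ i, pivot K i ∈ Submodule.span K
        {D | ∃ s : ℤ, D ∈ shift K letterSwt s ∧ D ∈ triangularDer K (s : ZMod 2)} := fun i =>
      Submodule.subset_span ⟨-letterSwt i, pivot_mem_shift i, by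
        rw [Int.cast_neg, letterSwt_cast]
        exact pivot_mem_triangularDer i⟩
    rintro _ (rfl | rfl)
    exacts [h 0, h 1]

theorem mem_triangularDer_zero_of_mem_lieR {D : Module.End K (Grassmann K)} (hD : D ∈ lieR K)
    (h0 : D ∈ shift K letterSwt 0) : D ∈ triangularDer K 0 := by
  refine Submodule.span_le.2 ?_ (mem_span_inter_of_iSupIndep (iSupIndep_shift letterSwt)
    (by rintro g ⟨s, hs, _⟩; exact ⟨s, hs⟩) (lieR_le_span_triangularDer hD) h0)
  rintro g ⟨⟨s, hs, hs'⟩, h0⟩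
  by_cases h : s = 0
  · subst h; simpa using hs'
  · rw [Submodule.disjoint_def.1 ((iSupIndep_shift letterSwt).pairwiseDisjoint h) g hs h0]
    exact zero_mem _

end Derivations

/-! ### Decomposition of `algA` and `lieR` by the sign of the superweight. -/

section SignParts

variable {K : Type*} [Field K]

theorem signPart_le (L : Submodule K (Module.End K (Grassmann K))) (σ : SignType) :
    signPart L σ ≤ L := Submodule.span_le.2 fun _ hw => hw.1

theorem iSup_signPart {L : Submodule K (Module.End K (Grassmann K))}
    (hL : L ≤ Submodule.span K {w | w ∈ L ∧ ∃ s : ℤ, IsMonomial s w}) :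
    iSup (signPart L) = L := by
  refine le_antisymm (iSup_le (signPart_le L)) (hL.trans (Submodule.span_le.2 ?_))
  rintro w ⟨hw, s, hs⟩
  exact Submodule.mem_iSup_of_mem (SignType.sign s) (Submodule.subset_span ⟨hw, s, rfl, hs⟩)

/-- Each part sits in the sum of the spaces `shift` over the integers of its sign, and these index
sets are disjoint for different signs. -/
theorem iSupIndep_signPart (L : Submodule K (Module.End K (Grassmann K))) :
    iSupIndep (signPart L) := by
  have h : ∀ σ, signPart L σ ≤
      ⨆ s ∈ {s : ℤ | SignType.sign s = σ}, shift K letterSwt s := fun σ =>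
    Submodule.span_le.2 fun w hw => by
      obtain ⟨-, s, hs, hm⟩ := hw
      exact Submodule.mem_iSup_of_mem s (Submodule.mem_iSup_of_mem hs hm.mem_shift)
  intro σ
  refine ((iSupIndep_shift (K := K) letterSwt).disjoint_biSup_biSup
    (s := {s : ℤ | SignType.sign s = σ}) (t := {s : ℤ | SignType.sign s ≠ σ}) ?_).mono (h σ) ?_
  · exact Set.disjoint_left.2 fun s hs ht => ht hs
  · refine iSup₂_le fun τ hτ => (h τ).trans (biSup_mono fun s hs => ?_)
    exact fun h => hτ (hs.symm.trans h)

theorem sign_add_of_sign_eq {s t : ℤ} {σ : SignType} (hs : SignType.sign s = σ)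
    (ht : SignType.sign t = σ) : SignType.sign (s + t) = σ := by
  subst hs
  rcases lt_trichotomy s 0 with h | h | h
  · rw [sign_neg h, sign_eq_neg_one_iff] at *; omega
  · subst h; rw [zero_add, ht]
  · rw [sign_pos h, sign_eq_one_iff] at *; omega

theorem pivot_mem_algA_zero : pivot K 0 ∈ algA K :=
  NonUnitalAlgebra.subset_adjoin K (by simp)

theorem pivot_mem_algA_one : pivot K 1 ∈ algA K :=
  NonUnitalAlgebra.subset_adjoin K (by simp)

theorem mul_mem_algA {x y : Module.End K (Grassmann K)} (hx : x ∈ algA K) (hy : y ∈ algA K) :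
    x * y ∈ algA K :=
  mul_mem (S := NonUnitalSubalgebra K (Module.End K (Grassmann K))) hx hy

theorem algA_le_span_monomials :
    algA K ≤ Submodule.span K {w | w ∈ algA K ∧ ∃ s : ℤ, IsMonomial s w} := by
  intro x hx
  change x ∈ NonUnitalAlgebra.adjoin K _ at hx
  induction hx using NonUnitalAlgebra.adjoin_induction with
  | mem x hx =>
    rcases hx with rfl | rfl
    · exact Submodule.subset_span ⟨pivot_mem_algA_zero, _, IsMonomial.pivot 0⟩
    · exact Submodule.subset_span ⟨pivot_mem_algA_one, _, IsMonomial.pivot 1⟩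
  | add x y _ _ hx hy => exact add_mem hx hy
  | zero => exact zero_mem _
  | mul x y _ _ hx hy =>
    have h := Submodule.mul_mem_mul hx hy
    rw [Submodule.span_mul_span] at h
    refine Submodule.span_mono ?_ h
    rintro _ ⟨w, ⟨hw, s, hs⟩, u, ⟨hu, t, ht⟩, rfl⟩
    exact ⟨mul_mem_algA hw hu, _, hs.mul ht⟩
  | smul c x _ hx => exact Submodule.smul_mem _ c hx

theorem mul_mem_signPart_algA {σ : SignType} {x y : Module.End K (Grassmann K)}
    (hx : x ∈ signPart (algA K) σ) (hy : y ∈ signPart (algA K) σ) :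
    x * y ∈ signPart (algA K) σ := by
  have h := Submodule.mul_mem_mul hx hy
  unfold signPart at h
  rw [Submodule.span_mul_span] at h
  refine Submodule.span_mono ?_ h
  rintro _ ⟨w, ⟨hw, s, hs, hws⟩, u, ⟨hu, t, ht, hut⟩, rfl⟩
  exact ⟨mul_mem_algA hw hu, _, sign_add_of_sign_eq hs ht, hws.mul hut⟩

theorem isLieSuperSubalgebra_lieClosure (S : Set (Module.End K (Grassmann K))) :
    IsLieSuperSubalgebra (lieClosure S) where
  bracket_mem x hx y hy := Submodule.mem_sInf.2 fun B hB =>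
    hB.1.bracket_mem x (Submodule.mem_sInf.1 hx B hB) y (Submodule.mem_sInf.1 hy B hB)
  sq_mem x hx hodd := Submodule.mem_sInf.2 fun B hB =>
    hB.1.sq_mem x (Submodule.mem_sInf.1 hx B hB) hodd

theorem subset_lieClosure (S : Set (Module.End K (Grassmann K))) : S ⊆ lieClosure S :=
  fun _ hx => Submodule.mem_sInf.2 fun _ hB => hB.2 hx

theorem lieClosure_le {S : Set (Module.End K (Grassmann K))}
    {B : Submodule K (Module.End K (Grassmann K))} (hB : IsLieSuperSubalgebra B) (hS : S ⊆ B) :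
    lieClosure S ≤ B := sInf_le ⟨hB, hS⟩

theorem lieR_le_span_monomials :
    lieR K ≤ Submodule.span K {w | w ∈ lieR K ∧ ∃ s : ℤ, IsMonomial s w} := by
  have hR := isLieSuperSubalgebra_lieClosure ({pivot K 0, pivot K 1} : Set _)
  refine lieClosure_le (isLieSuperSubalgebra_span ?_ ?_ ?_) ?_
  · rintro g ⟨-, s, hs⟩
    exact ⟨s, hs.mem_shift⟩
  · rintro g ⟨hg, s, hs⟩ h ⟨hh, t, ht⟩
    exact Submodule.subset_span ⟨hR.bracket_mem g hg h hh, _, hs.bracket ht⟩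
  · rintro g ⟨hg, s, hs⟩ hodd
    exact Submodule.subset_span ⟨hR.sq_mem g hg hodd, _, hs.mul hs⟩
  · rintro w (rfl | rfl)
    · exact Submodule.subset_span ⟨subset_lieClosure _ (by simp), _, IsMonomial.pivot 0⟩
    · exact Submodule.subset_span ⟨subset_lieClosure _ (by simp), _, IsMonomial.pivot 1⟩

theorem isLieSuperSubalgebra_signPart_lieR (σ : SignType) :
    IsLieSuperSubalgebra (signPart (lieR K) σ) := by
  have hR := isLieSuperSubalgebra_lieClosure ({pivot K 0, pivot K 1} : Set _)
  refine isLieSuperSubalgebra_span ?_ ?_ ?_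
  · rintro g ⟨-, s, -, hs⟩
    exact ⟨s, hs.mem_shift⟩
  · rintro g ⟨hg, s, hsσ, hs⟩ h ⟨hh, t, htσ, ht⟩
    exact Submodule.subset_span
      ⟨hR.bracket_mem g hg h hh, _, sign_add_of_sign_eq hsσ htσ, hs.bracket ht⟩
  · rintro g ⟨hg, s, hsσ, hs⟩ hodd
    exact Submodule.subset_span
      ⟨hR.sq_mem g hg hodd, _, sign_add_of_sign_eq hsσ hsσ, hs.mul hs⟩

/-- For a general operator the supercommutator involves parity components that need not belong to
the algebra. The comparison therefore runs through homogeneous monomials, where the bracket is a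
combination of two products. -/
theorem lieR_le_algA : lieR K ≤ algA K := by
  intro x hx
  have h : lieR K ≤ Submodule.span K {w | w ∈ algA K ∧ ∃ s : ℤ, IsMonomial s w} := by
    refine lieClosure_le (isLieSuperSubalgebra_span ?_ ?_ ?_) ?_
    · rintro g ⟨-, s, hs⟩
      exact ⟨s, hs.mem_shift⟩
    · rintro g ⟨hg, s, hs⟩ h ⟨hh, t, ht⟩
      refine Submodule.subset_span ⟨?_, _, hs.bracket ht⟩
      rw [superBracket_of_mem_shift hs.mem_shift ht.mem_shift]
      exact sub_mem (mul_mem_algA hg hh) (Submodule.smul_mem _ _ (mul_mem_algA hh hg))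
    · rintro g ⟨hg, s, hs⟩ hodd
      exact Submodule.subset_span ⟨mul_mem_algA hg hg, _, hs.mul hs⟩
    · rintro w (rfl | rfl)
      · exact Submodule.subset_span ⟨pivot_mem_algA_zero, _, IsMonomial.pivot 0⟩
      · exact Submodule.subset_span ⟨pivot_mem_algA_one, _, IsMonomial.pivot 1⟩
  exact Submodule.span_le.2 (fun w hw => hw.1) (h hx)

end SignParts

/-! ### From vanishing powers of a subspace to nilpotency of generated algebras. -/

section Nilpotency

variable {K : Type*} [Field K]

theorem pow_eq_bot_of_le {A : Type*} [Semiring A] [Algebra K A] {V : Submodule K A} {n m : ℕ}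
    (hV : V ^ n = ⊥) (h : n ≤ m) : V ^ m = ⊥ := by
  rw [← Nat.add_sub_cancel' h, pow_add, hV, Submodule.bot_mul]

/-- Without a unit, every element of the generated algebra is a sum of words of length at least one,
so an `n`-fold product is a sum of words of length at least `n`. -/
theorem adjoin_pow_eq_bot {A : Type*} [Ring A] [Algebra K A] {S : Set A} {V : Submodule K A}
    (hS : S ⊆ V) {n : ℕ} (hV : V ^ n = ⊥) :
    (NonUnitalAlgebra.adjoin K S).toSubmodule ^ n = ⊥ := by
  have hmul : ∀ i j, (⨆ m, V ^ (i + m)) * (⨆ m, V ^ (j + m)) ≤ ⨆ m, V ^ (i + j + m) := by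
    intro i j
    rw [Submodule.iSup_mul]
    refine iSup_le fun a => ?_
    rw [Submodule.mul_iSup]
    refine iSup_le fun b => ?_
    rw [← pow_add, show i + a + (j + b) = i + j + (a + b) by ring]
    exact le_iSup (fun m => V ^ (i + j + m)) (a + b)
  have h1 : (NonUnitalAlgebra.adjoin K S).toSubmodule ≤ ⨆ m, V ^ (1 + m) := by
    intro x hx
    change x ∈ NonUnitalAlgebra.adjoin K S at hx
    induction hx using NonUnitalAlgebra.adjoin_induction with
    | mem x hx => exact Submodule.mem_iSup_of_mem 0 (by simpa using hS hx)
    | add x y _ _ hx hy => exact add_mem hx hy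
    | zero => exact zero_mem _
    | mul x y _ _ hx hy =>
      have h : (⨆ m, V ^ (1 + 1 + m)) ≤ ⨆ m, V ^ (1 + m) := iSup_le fun m => by
        rw [add_assoc]
        exact le_iSup (fun m => V ^ (1 + m)) (1 + m)
      exact h (hmul 1 1 (Submodule.mul_mem_mul hx hy))
    | smul c x _ hx => exact Submodule.smul_mem _ c hx
  have h2 : ∀ k, (⨆ m, V ^ (1 + m)) ^ k ≤ ⨆ m, V ^ (k + m) := by
    intro k
    induction k with
    | zero => exact le_iSup_of_le 0 (by simp)
    | succ k ih =>
      rw [pow_succ]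
      exact (mul_le_mul' ih le_rfl).trans (hmul k 1)
  refine le_bot_iff.1 ((pow_le_pow_left' h1 n).trans ((h2 n).trans (iSup_le fun m => ?_)))
  exact (pow_eq_bot_of_le hV (Nat.le_add_right n m)).le

/-- The homogeneous elements of the powers `V ^ m`, `m ≥ k`. -/
def homogeneousPowers (V : Submodule K (Module.End K (Grassmann K))) (k : ℕ) :
    Set (Module.End K (Grassmann K)) :=
  {w | ∃ m, k ≤ m ∧ w ∈ V ^ m ∧ ∃ s, w ∈ shift K letterSwt s}

theorem homogeneousPowers_anti (V : Submodule K (Module.End K (Grassmann K))) {k l : ℕ}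
    (h : k ≤ l) : homogeneousPowers V l ⊆ homogeneousPowers V k :=
  fun _ ⟨m, hm, hw⟩ => ⟨m, h.trans hm, hw⟩

theorem mul_mem_homogeneousPowers {V : Submodule K (Module.End K (Grassmann K))} {k l : ℕ}
    {g h : Module.End K (Grassmann K)} (hg : g ∈ homogeneousPowers V k)
    (hh : h ∈ homogeneousPowers V l) : g * h ∈ homogeneousPowers V (k + l) := by
  obtain ⟨m, hm, hgm, s, hs⟩ := hg
  obtain ⟨n, hn, hhn, t, ht⟩ := hh
  exact ⟨m + n, add_le_add hm hn, pow_add V m n ▸ Submodule.mul_mem_mul hgm hhn, s + t,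
    mul_mem_shift hs ht⟩

theorem superBracket_mem_homogeneousPowers {V : Submodule K (Module.End K (Grassmann K))} {k l : ℕ}
    {g h : Module.End K (Grassmann K)} (hg : g ∈ homogeneousPowers V k)
    (hh : h ∈ homogeneousPowers V l) :
    superBracket g h ∈ Submodule.span K (homogeneousPowers V (k + l)) := by
  have h1 := mul_mem_homogeneousPowers hg hh
  have h2 := mul_mem_homogeneousPowers hh hg
  rw [add_comm] at h2
  obtain ⟨_, _, _, s, hs⟩ := hg
  obtain ⟨_, _, _, t, ht⟩ := hh
  rw [superBracket_of_mem_shift hs ht]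
  exact sub_mem (Submodule.subset_span h1) (Submodule.smul_mem _ _ (Submodule.subset_span h2))

theorem sq_mem_span_homogeneousPowers {V : Submodule K (Module.End K (Grassmann K))} {k l : ℕ}
    (hl : l ≤ k + k) {x : Module.End K (Grassmann K)}
    (hx : x ∈ Submodule.span K (homogeneousPowers V k)) (hodd : IsOdd x) :
    x * x ∈ Submodule.span K (homogeneousPowers V l) :=
  Submodule.span_mono (homogeneousPowers_anti V hl) <| sq_mem_of_span
    (by rintro g ⟨_, _, _, hs⟩; exact hs)
    (fun _ hg _ hh => superBracket_mem_homogeneousPowers hg hh)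
    (fun _ hg _ => Submodule.subset_span (mul_mem_homogeneousPowers hg hg)) hx hodd

/-- The spans of the homogeneous elements in the powers of order at least `k` form a filtration that
adds indices under brackets and doubles them under squares; it dominates the lower central series
term by term. -/
theorem lowerCentral_eq_bot {S T : Set (Module.End K (Grassmann K))}
    (hT : ∀ g ∈ T, ∃ s, g ∈ shift K letterSwt s) (hS : S ⊆ Submodule.span K T) {n : ℕ}
    (hn : Submodule.span K T ^ n = ⊥) : lowerCentral (lieClosure S) (n + 1) = ⊥ := by
  set V := Submodule.span K T with hVdef
  set N : ℕ → Submodule K (Module.End K (Grassmann K)) :=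
    fun k => Submodule.span K (homogeneousPowers V k) with hN
  have hVN : V ≤ N 1 := Submodule.span_mono fun g hg =>
    ⟨1, le_rfl, by rw [pow_one]; exact Submodule.subset_span hg, hT g hg⟩
  have hbr : ∀ k l, ∀ x ∈ N k, ∀ y ∈ N l, superBracket x y ∈ N (k + l) := fun k l x hx y hy =>
    superBracket_mem_of_span (fun g hg h hh => superBracket_mem_homogeneousPowers hg hh) hx hy
  have hanti : ∀ k l, k ≤ l → N l ≤ N k := fun k l h =>
    Submodule.span_mono (homogeneousPowers_anti V h)
  have hclos : lieClosure S ≤ N 1 := lieClosure_le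
    ⟨fun x hx y hy => hanti 1 2 (by omega) (hbr 1 1 x hx y hy),
      fun x hx hodd => sq_mem_span_homogeneousPowers (by omega) hx hodd⟩ (hS.trans hVN)
  have hlow : ∀ k, 1 ≤ k → lowerCentral (lieClosure S) k ≤ N k := by
    intro k
    induction k using Nat.strong_induction_on with
    | _ k ih =>
      intro hk
      match k, ih, hk with
      | 1, _, _ => rw [lowerCentral]; exact hclos
      | k + 2, ih, _ =>
        rw [lowerCentral, Submodule.span_le]
        rintro z (⟨x, hx, y, hy, rfl⟩ | ⟨x, hx, hodd, rfl⟩)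
        · have := hbr 1 (k + 1) x (hclos hx) y (ih (k + 1) (by omega) (by omega) hy)
          rwa [show 1 + (k + 1) = k + 2 by ring] at this
        -- The index `(k + 3) / 2` is half of `k + 2` rounded up, so its double is at least `k + 2`.
        · exact sq_mem_span_homogeneousPowers (by omega)
            (ih ((k + 3) / 2) (by omega) (by omega) hx) hodd
  -- The comparison starts at index one; taking `n + 1` covers `n = 0` as well.
  refine le_bot_iff.1 ((hlow (n + 1) (by omega)).trans (Submodule.span_le.2 ?_))
  rintro w ⟨m, hm, hw, -⟩
  rwa [pow_eq_bot_of_le hn (by omega)] at hw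

/-- A finite subset of the span of `G` lies in the span of a finite subset of `G`. -/
theorem exists_finite_subset_span {M : Type*} [AddCommGroup M] [Module K M] {G S : Set M}
    (hfin : S.Finite) (hS : S ⊆ Submodule.span K G) :
    ∃ T : Set M, T.Finite ∧ T ⊆ G ∧ S ⊆ Submodule.span K T := by
  lift S to Finset M using hfin
  obtain ⟨T, hT, h⟩ := Submodule.subset_span_finite_of_subset_span hS
  exact ⟨T, T.finite_toSet, hT, h⟩

/-- Finitely many elements involve only finitely many homogeneous monomials of the given sign, so it
suffices to treat finite sets of homogeneous operators. -/
theorem isLocallyNilpotentAssoc_signPart {L : Submodule K (Module.End K (Grassmann K))}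
    {σ : SignType}
    (h : ∀ T : Set (Module.End K (Grassmann K)), T.Finite →
      T ⊆ {w | w ∈ L ∧ ∃ s : ℤ, SignType.sign s = σ ∧ w ∈ shift K letterSwt s} →
      ∃ n, Submodule.span K T ^ n = ⊥) : IsLocallyNilpotentAssoc (signPart L σ) := by
  intro S hfin hS
  obtain ⟨T, hTf, hT, hST⟩ := exists_finite_subset_span hfin hS
  obtain ⟨n, hn⟩ := h T hTf fun w hw => by
    obtain ⟨h1, s, h2, h3⟩ := hT hw
    exact ⟨h1, s, h2, h3.mem_shift⟩
  exact ⟨n, adjoin_pow_eq_bot hST hn⟩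

theorem isLocallyNilpotentLie_signPart {L : Submodule K (Module.End K (Grassmann K))}
    {σ : SignType}
    (h : ∀ T : Set (Module.End K (Grassmann K)), T.Finite →
      T ⊆ {w | w ∈ L ∧ ∃ s : ℤ, SignType.sign s = σ ∧ w ∈ shift K letterSwt s} →
      ∃ n, Submodule.span K T ^ n = ⊥) : IsLocallyNilpotentLie (signPart L σ) := by
  intro S hfin hS
  obtain ⟨T, hTf, hT, hST⟩ := exists_finite_subset_span hfin hS
  obtain ⟨n, hn⟩ := h T hTf fun w hw => by
    obtain ⟨h1, s, h2, h3⟩ := hT hw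
    exact ⟨h1, s, h2, h3.mem_shift⟩
  refine ⟨n + 1, lowerCentral_eq_bot (fun g hg => ?_) hST hn⟩
  obtain ⟨-, s, -, h3⟩ := hT hg
  exact ⟨s, h3.mem_shift⟩

end Nilpotency

/-! ### Halving of words in the pivot elements. -/

section Reduction

variable (K : Type*) [Field K]

/-- The operator `x_n v_{n+1}`. -/
noncomputable def pivotSq (n : ℕ) : Module.End K (Grassmann K) := letter K n * pivot K (n + 1)

/-- A basis of the Clifford algebra generated by `x_n` and `∂_n`. -/
noncomputable def cliffordSet (n : ℕ) : Set (Module.End K (Grassmann K)) :=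
  {1, letter K n, partialD K n, letter K n * partialD K n}

/-- The Clifford algebra generated by the operators `x_n` and `∂_n`. -/
noncomputable def cliffordPart (n : ℕ) : Submodule K (Module.End K (Grassmann K)) :=
  Submodule.span K (cliffordSet K n)

/-- The operators `1`, `v_n` and `x_n v_{n+1}`. -/
noncomputable def tailSet (n : ℕ) : Set (Module.End K (Grassmann K)) := {1, pivot K n, pivotSq K n}

/-- The span of `1`, `v_n` and `x_n v_{n+1}`. -/
noncomputable def tailPart (n : ℕ) : Submodule K (Module.End K (Grassmann K)) :=
  Submodule.span K (tailSet K n)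

/-- The algebra generated by the operators `x_i` and `∂_i` with `i < n`. -/
noncomputable def headPart : ℕ → Submodule K (Module.End K (Grassmann K))
  | 0 => 1
  | n + 1 => headPart n * cliffordPart K n

theorem letter_mul_self (n : ℕ) : letter K n * letter K n = 0 :=
  LinearMap.ext fun f => gen_mul_gen_mul_self n f

theorem partialD_mul_self (n : ℕ) : partialD K n * partialD K n = 0 :=
  LinearMap.ext fun f => partialD_sq K n f

theorem partialD_mul_letter (n : ℕ) :
    partialD K n * letter K n = 1 - letter K n * partialD K n :=
  LinearMap.ext fun f => partialD_gen_mul_self n f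

theorem pivot_eq (n : ℕ) : pivot K n = partialD K n + letter K n * pivotSq K (n + 1) :=
  LinearMap.ext fun f => pivot_apply n f

theorem pivot_mul_letter {m n : ℕ} (h : m < n) :
    pivot K n * letter K m = (-1 : K) • (letter K m * pivot K n) :=
  LinearMap.ext fun f => (pivot_gen_mul_of_lt h f).trans (neg_one_smul K _).symm

theorem pivot_mul_partialD {m n : ℕ} (h : m < n) :
    pivot K n * partialD K m = (-1 : K) • (partialD K m * pivot K n) :=
  LinearMap.ext fun f => (pivot_partialD h f).trans (neg_one_smul K _).symm

theorem pivotSq_mul_letter {m n : ℕ} (h : m < n) :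
    pivotSq K n * letter K m = (1 : K) • (letter K m * pivotSq K n) := by
  rw [one_smul]
  refine LinearMap.ext fun f => ?_
  change gen K n * pivot K (n + 1) (gen K m * f) = gen K m * (gen K n * pivot K (n + 1) f)
  rw [pivot_gen_mul_of_lt (by omega), mul_neg, gen_mul_gen_mul n m, neg_neg]

theorem pivotSq_mul_partialD {m n : ℕ} (h : m < n) :
    pivotSq K n * partialD K m = (1 : K) • (partialD K m * pivotSq K n) := by
  rw [one_smul]
  refine LinearMap.ext fun f => ?_
  change gen K n * pivot K (n + 1) (partialD K m f) =
    partialD K m (gen K n * pivot K (n + 1) f)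
  rw [pivot_partialD (by omega), mul_neg, partialD_gen_mul_of_ne (by omega)]

/-- The scalar is the parity sign of `q`: `v_n` is odd, while `1` and `x_n v_{n+1}` are even. Hence
it is the same for `x_m` and `∂_m`. -/
theorem exists_tail_sign {m n : ℕ} (h : m < n) {q : Module.End K (Grassmann K)}
    (hq : q ∈ tailSet K n) : ∃ c : K, q * letter K m = c • (letter K m * q) ∧
      q * partialD K m = c • (partialD K m * q) := by
  rcases hq with rfl | rfl | rfl
  · exact ⟨1, by simp, by simp⟩
  · exact ⟨-1, pivot_mul_letter K h, pivot_mul_partialD K h⟩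
  · exact ⟨1, pivotSq_mul_letter K h, pivotSq_mul_partialD K h⟩

theorem tail_mul_clifford {m n : ℕ} (h : m < n) :
    tailPart K n * cliffordPart K m ≤ cliffordPart K m * tailPart K n := by
  unfold tailPart cliffordPart
  rw [Submodule.span_mul_span, Submodule.span_le]
  rintro _ ⟨q, hq, e, he, rfl⟩
  obtain ⟨c, hx, hd⟩ := exists_tail_sign K h hq
  obtain ⟨c', hc'⟩ : ∃ c' : K, q * e = c' • (e * q) := by
    rcases he with rfl | rfl | rfl | rfl
    · exact ⟨1, by simp⟩
    · exact ⟨c, hx⟩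
    · exact ⟨c, hd⟩
    · refine ⟨c * c, ?_⟩
      rw [← mul_assoc, hx, smul_mul_assoc, mul_assoc, hd, mul_smul_comm, smul_smul, mul_assoc]
  change q * e ∈ _
  rw [hc']
  exact Submodule.smul_mem _ _
    (Submodule.mul_mem_mul (Submodule.subset_span he) (Submodule.subset_span hq))

theorem one_mem_cliffordPart (n : ℕ) : (1 : Module.End K (Grassmann K)) ∈ cliffordPart K n :=
  Submodule.subset_span (by simp [cliffordSet])

theorem letter_mem_cliffordPart (n : ℕ) : letter K n ∈ cliffordPart K n :=
  Submodule.subset_span (by simp [cliffordSet])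

theorem partialD_mem_cliffordPart (n : ℕ) : partialD K n ∈ cliffordPart K n :=
  Submodule.subset_span (by simp [cliffordSet])

theorem letter_mul_partialD_mem_cliffordPart (n : ℕ) :
    letter K n * partialD K n ∈ cliffordPart K n :=
  Submodule.subset_span (by simp [cliffordSet])

theorem letter_mul_mem_cliffordPart {n : ℕ} {w : Module.End K (Grassmann K)}
    (hw : w ∈ cliffordPart K n) : letter K n * w ∈ cliffordPart K n := by
  induction hw using Submodule.span_induction with
  | mem w hw =>
    rcases hw with rfl | rfl | rfl | rfl
    · rw [mul_one]; exact letter_mem_cliffordPart K n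
    · rw [letter_mul_self]; exact zero_mem _
    · exact letter_mul_partialD_mem_cliffordPart K n
    · rw [← mul_assoc, letter_mul_self, zero_mul]; exact zero_mem _
  | zero => rw [mul_zero]; exact zero_mem _
  | add f g _ _ hf hg => rw [mul_add]; exact add_mem hf hg
  | smul c f _ hf => rw [mul_smul_comm]; exact Submodule.smul_mem _ c hf

theorem partialD_mul_mem_cliffordPart {n : ℕ} {w : Module.End K (Grassmann K)}
    (hw : w ∈ cliffordPart K n) : partialD K n * w ∈ cliffordPart K n := by
  induction hw using Submodule.span_induction with
  | mem w hw =>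
    rcases hw with rfl | rfl | rfl | rfl
    · rw [mul_one]; exact partialD_mem_cliffordPart K n
    · rw [partialD_mul_letter]
      exact sub_mem (one_mem_cliffordPart K n) (letter_mul_partialD_mem_cliffordPart K n)
    · rw [partialD_mul_self]; exact zero_mem _
    · rw [← mul_assoc, partialD_mul_letter, sub_mul, one_mul, mul_assoc, partialD_mul_self,
        mul_zero, sub_zero]
      exact partialD_mem_cliffordPart K n
  | zero => rw [mul_zero]; exact zero_mem _
  | add f g _ _ hf hg => rw [mul_add]; exact add_mem hf hg
  | smul c f _ hf => rw [mul_smul_comm]; exact Submodule.smul_mem _ c hf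

theorem clifford_mul_clifford (n : ℕ) :
    cliffordPart K n * cliffordPart K n ≤ cliffordPart K n := by
  refine Submodule.mul_le.2 fun a ha b hb => ?_
  induction ha using Submodule.span_induction with
  | mem a ha =>
    rcases ha with rfl | rfl | rfl | rfl
    · rwa [one_mul]
    · exact letter_mul_mem_cliffordPart K hb
    · exact partialD_mul_mem_cliffordPart K hb
    · rw [mul_assoc]
      exact letter_mul_mem_cliffordPart K (partialD_mul_mem_cliffordPart K hb)
  | zero => rw [zero_mul]; exact zero_mem _
  | add f g _ _ hf hg => rw [add_mul]; exact add_mem hf hg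
  | smul c f _ hf => rw [smul_mul_assoc]; exact Submodule.smul_mem _ c hf

theorem one_mem_tailPart (n : ℕ) : (1 : Module.End K (Grassmann K)) ∈ tailPart K n :=
  Submodule.subset_span (by simp [tailSet])

theorem pivot_mem_tailPart (n : ℕ) : pivot K n ∈ tailPart K n :=
  Submodule.subset_span (by simp [tailSet])

theorem pivotSq_mem_tailPart (n : ℕ) : pivotSq K n ∈ tailPart K n :=
  Submodule.subset_span (by simp [tailSet])

theorem one_le_tailPart (n : ℕ) : 1 ≤ tailPart K n := Submodule.one_le.2 (one_mem_tailPart K n)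

theorem pivot_mem_clifford_mul_tail (n : ℕ) :
    pivot K n ∈ cliffordPart K n * tailPart K (n + 1) := by
  rw [pivot_eq]
  refine add_mem ?_ (Submodule.mul_mem_mul (letter_mem_cliffordPart K n)
    (pivotSq_mem_tailPart K (n + 1)))
  rw [← mul_one (partialD K n)]
  exact Submodule.mul_mem_mul (partialD_mem_cliffordPart K n) (one_mem_tailPart K (n + 1))

/-- Write `v_n = ∂_n + x_n y` with `y = pivotSq K (n + 1)` commuting with `x_n` and `∂_n`: the pure
squares vanish and `∂_n x_n + x_n ∂_n = 1`. -/
theorem pivot_mul_pivot (n : ℕ) : pivot K n * pivot K n = pivotSq K (n + 1) := by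
  have h1 := pivotSq_mul_letter K (Nat.lt_succ_self n)
  have h2 := pivotSq_mul_partialD K (Nat.lt_succ_self n)
  rw [Nat.succ_eq_add_one, one_smul] at h1 h2
  rw [pivot_eq, add_mul, mul_add, mul_add, partialD_mul_self, ← mul_assoc, partialD_mul_letter,
    mul_assoc (letter K n) _ (partialD K n), h2,
    mul_assoc (letter K n) _ (letter K n * pivotSq K (n + 1)), ← mul_assoc (pivotSq K (n + 1)), h1,
    mul_assoc (letter K n) (pivotSq K (n + 1)), ← mul_assoc (letter K n) (letter K n),
    letter_mul_self, sub_mul]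
  noncomm_ring

theorem pivot_mul_pivotSq (n : ℕ) :
    pivot K n * pivotSq K n = (1 - letter K n * partialD K n) * pivot K (n + 1) := by
  have h1 := pivotSq_mul_letter K (Nat.lt_succ_self n)
  rw [Nat.succ_eq_add_one, one_smul] at h1
  rw [pivot_eq K n, pivotSq.eq_def K n, add_mul, ← mul_assoc, partialD_mul_letter,
    mul_assoc (letter K n) (pivotSq K (n + 1)), ← mul_assoc (pivotSq K (n + 1)), h1,
    mul_assoc (letter K n) (pivotSq K (n + 1)), ← mul_assoc (letter K n) (letter K n),
    letter_mul_self, zero_mul, add_zero]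

theorem pivotSq_mul_pivot (n : ℕ) :
    pivotSq K n * pivot K n = (-1 : K) • ((letter K n * partialD K n) * pivot K (n + 1)) := by
  have h1 := pivot_mul_letter K (Nat.lt_succ_self n)
  have h2 := pivot_mul_partialD K (Nat.lt_succ_self n)
  rw [Nat.succ_eq_add_one] at h1 h2
  rw [pivot_eq K n, pivotSq.eq_def K n, mul_add, mul_assoc, h2, mul_assoc (letter K n) _
    (letter K n * pivotSq K (n + 1)), ← mul_assoc (pivot K (n + 1)), h1, smul_mul_assoc,
    mul_smul_comm, mul_smul_comm, mul_assoc (letter K n) (pivot K (n + 1)),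
    ← mul_assoc (letter K n) (letter K n), letter_mul_self, zero_mul, smul_zero, add_zero,
    mul_assoc (letter K n)]

theorem pivotSq_mul_pivotSq (n : ℕ) : pivotSq K n * pivotSq K n = 0 := by
  have h1 := pivot_mul_letter K (Nat.lt_succ_self n)
  rw [Nat.succ_eq_add_one] at h1
  rw [pivotSq.eq_def, mul_assoc, ← mul_assoc (pivot K (n + 1)), h1, smul_mul_assoc,
    mul_smul_comm, mul_assoc (letter K n) (pivot K (n + 1)), ← mul_assoc (letter K n) (letter K n),
    letter_mul_self, zero_mul, smul_zero]

/-- Two tail operators of level `n` are traded for one of level `n + 1` and a Clifford factor. This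
is the source of the logarithmic bound. -/
theorem tail_mul_tail (n : ℕ) :
    tailPart K n * tailPart K n ≤ cliffordPart K n * tailPart K (n + 1) := by
  have hC : ∀ {q}, q ∈ tailPart K (n + 1) → q ∈ cliffordPart K n * tailPart K (n + 1) :=
    fun {q} hq => by
      rw [← one_mul q]
      exact Submodule.mul_mem_mul (one_mem_cliffordPart K n) hq
  have hy : pivotSq K n ∈ cliffordPart K n * tailPart K (n + 1) :=
    Submodule.mul_mem_mul (letter_mem_cliffordPart K n) (pivot_mem_tailPart K (n + 1))
  have hv := pivot_mem_clifford_mul_tail K n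
  rw [tailPart, Submodule.span_mul_span, Submodule.span_le]
  rintro _ ⟨p, hp, q, hq, rfl⟩
  change p * q ∈ cliffordPart K n * tailPart K (n + 1)
  rcases hp with rfl | rfl | rfl <;> rcases hq with rfl | rfl | rfl
  · rw [one_mul]; exact hC (one_mem_tailPart K _)
  · rwa [one_mul]
  · rwa [one_mul]
  · rwa [mul_one]
  · rw [pivot_mul_pivot]; exact hC (pivotSq_mem_tailPart K _)
  · rw [pivot_mul_pivotSq]
    exact Submodule.mul_mem_mul
      (sub_mem (one_mem_cliffordPart K n) (letter_mul_partialD_mem_cliffordPart K n))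
      (pivot_mem_tailPart K _)
  · rwa [mul_one]
  · rw [pivotSq_mul_pivot]
    exact Submodule.smul_mem _ _ (Submodule.mul_mem_mul
      (letter_mul_partialD_mem_cliffordPart K n) (pivot_mem_tailPart K _))
  · rw [pivotSq_mul_pivotSq]; exact zero_mem _

theorem tail_pow_mul_clifford {m n : ℕ} (h : m < n) (k : ℕ) :
    tailPart K n ^ k * cliffordPart K m ≤ cliffordPart K m * tailPart K n ^ k := by
  induction k with
  | zero => rw [pow_zero, one_mul, mul_one]
  | succ k ih =>
    calc tailPart K n ^ (k + 1) * cliffordPart K m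
        = tailPart K n ^ k * (tailPart K n * cliffordPart K m) := by rw [pow_succ, mul_assoc]
      _ ≤ tailPart K n ^ k * (cliffordPart K m * tailPart K n) :=
          mul_le_mul' le_rfl (tail_mul_clifford K h)
      _ = tailPart K n ^ k * cliffordPart K m * tailPart K n := by rw [mul_assoc]
      _ ≤ cliffordPart K m * tailPart K n ^ k * tailPart K n := mul_le_mul' ih le_rfl
      _ = cliffordPart K m * tailPart K n ^ (k + 1) := by rw [pow_succ, mul_assoc]

theorem clifford_tail_mul {m n : ℕ} (h : m < n) (k l : ℕ) :
    cliffordPart K m * tailPart K n ^ k * (cliffordPart K m * tailPart K n ^ l) ≤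
      cliffordPart K m * tailPart K n ^ (k + l) :=
  calc cliffordPart K m * tailPart K n ^ k * (cliffordPart K m * tailPart K n ^ l)
      = cliffordPart K m * (tailPart K n ^ k * cliffordPart K m) * tailPart K n ^ l := by
        simp only [mul_assoc]
    _ ≤ cliffordPart K m * (cliffordPart K m * tailPart K n ^ k) * tailPart K n ^ l :=
        mul_le_mul' (mul_le_mul' le_rfl (tail_pow_mul_clifford K h k)) le_rfl
    _ = (cliffordPart K m * cliffordPart K m) * tailPart K n ^ (k + l) := by
        rw [pow_add]; simp only [mul_assoc]
    _ ≤ cliffordPart K m * tailPart K n ^ (k + l) :=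
        mul_le_mul' (clifford_mul_clifford K m) le_rfl

theorem tail_pow_two_mul (n k : ℕ) :
    tailPart K n ^ (2 * k) ≤ cliffordPart K n * tailPart K (n + 1) ^ k := by
  induction k with
  | zero =>
    rw [mul_zero, pow_zero, pow_zero, mul_one]
    exact Submodule.one_le.2 (one_mem_cliffordPart K n)
  | succ k ih =>
    rw [mul_add, mul_one, pow_add, pow_two]
    refine (mul_le_mul' ih ((tail_mul_tail K n).trans_eq ?_)).trans
      (clifford_tail_mul K (Nat.lt_succ_self n) k 1)
    rw [pow_one]

/-- Each halving moves one Clifford factor into the head and raises the level by one. -/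
theorem head_tail_pow_le (e : ℕ) : ∀ n, headPart K n * tailPart K n ^ 2 ^ e ≤
    headPart K (n + e) * tailPart K (n + e) := by
  induction e with
  | zero => intro n; rw [pow_zero, pow_one, add_zero]
  | succ e ih =>
    intro n
    calc headPart K n * tailPart K n ^ 2 ^ (e + 1)
        = headPart K n * tailPart K n ^ (2 * 2 ^ e) := by rw [pow_succ' 2 e]
      _ ≤ headPart K n * (cliffordPart K n * tailPart K (n + 1) ^ 2 ^ e) :=
          mul_le_mul' le_rfl (tail_pow_two_mul K n _)
      _ = headPart K (n + 1) * tailPart K (n + 1) ^ 2 ^ e := by rw [headPart, mul_assoc]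
      _ ≤ headPart K (n + 1 + e) * tailPart K (n + 1 + e) := ih (n + 1)
      _ = headPart K (n + (e + 1)) * tailPart K (n + (e + 1)) := by
          rw [add_assoc, add_comm 1 e]

theorem tail_pow_mono (n : ℕ) {k l : ℕ} (h : k ≤ l) : tailPart K n ^ k ≤ tailPart K n ^ l :=
  pow_le_pow_right' (one_le_tailPart K n) h

/-- A word of length at most `2 ^ e` is a combination of products of operators `x_i` and `∂_i`,
`i ≤ e`, followed by at most one tail operator. -/
theorem clifford_tail_pow_le {m e : ℕ} (h : m ≤ 2 ^ e) :
    cliffordPart K 0 * tailPart K 1 ^ m ≤ headPart K (e + 1) * tailPart K (e + 1) := by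
  have h1 := head_tail_pow_le K e 1
  rw [headPart, headPart, one_mul, add_comm 1 e] at h1
  exact (mul_le_mul' le_rfl (tail_pow_mono K 1 h)).trans h1

variable {K}

/-- Level one accommodates both generators: `v_1` is a tail operator there, and `v_0` becomes one
after its `∂_0` and `x_0` are put into the Clifford factor. Since `1` is a tail operator, the powers
increase and sums cause no trouble. -/
theorem exists_mem_clifford_tail_pow {a : Module.End K (Grassmann K)} (ha : a ∈ algA K) :
    ∃ m, a ∈ cliffordPart K 0 * tailPart K 1 ^ m := by
  have hmono : ∀ {k l : ℕ}, k ≤ l → cliffordPart K 0 * tailPart K 1 ^ k ≤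
      cliffordPart K 0 * tailPart K 1 ^ l := fun h => mul_le_mul' le_rfl (tail_pow_mono K 1 h)
  change a ∈ NonUnitalAlgebra.adjoin K _ at ha
  induction ha using NonUnitalAlgebra.adjoin_induction with
  | mem x hx =>
    refine ⟨1, ?_⟩
    rw [pow_one]
    rcases hx with rfl | rfl
    · exact pivot_mem_clifford_mul_tail K 0
    · rw [← one_mul (pivot K 1)]
      exact Submodule.mul_mem_mul (one_mem_cliffordPart K 0) (pivot_mem_tailPart K 1)
  | add x y _ _ hx hy =>
    obtain ⟨k, hk⟩ := hx
    obtain ⟨l, hl⟩ := hy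
    exact ⟨max k l, add_mem (hmono (le_max_left _ _) hk) (hmono (le_max_right _ _) hl)⟩
  | zero => exact ⟨0, zero_mem _⟩
  | mul x y _ _ hx hy =>
    obtain ⟨k, hk⟩ := hx
    obtain ⟨l, hl⟩ := hy
    exact ⟨k + l, clifford_tail_mul K Nat.zero_lt_one k l (Submodule.mul_mem_mul hk hl)⟩
  | smul c x _ hx =>
    obtain ⟨k, hk⟩ := hx
    exact ⟨k, Submodule.smul_mem _ c hk⟩

theorem exists_span_le_clifford_tail_pow {T : Set (Module.End K (Grassmann K))} (hT : T.Finite)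
    (hTA : T ⊆ algA K) : ∃ m, Submodule.span K T ≤ cliffordPart K 0 * tailPart K 1 ^ m := by
  induction T, hT using Set.Finite.induction_on with
  | empty => exact ⟨0, by simp⟩
  | insert _ _ ih =>
    rw [Set.insert_subset_iff] at hTA
    obtain ⟨k, hk⟩ := ih hTA.2
    obtain ⟨l, hl⟩ := exists_mem_clifford_tail_pow hTA.1
    refine ⟨max k l, Submodule.span_le.2 (Set.insert_subset ?_ fun x hx => ?_)⟩
    · exact mul_le_mul' le_rfl (tail_pow_mono K 1 (le_max_right k l)) hl
    · exact mul_le_mul' le_rfl (tail_pow_mono K 1 (le_max_left k l)) (hk (Submodule.subset_span hx))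

theorem pow_le_clifford_tail_pow {V : Submodule K (Module.End K (Grassmann K))} {m : ℕ}
    (hV : V ≤ cliffordPart K 0 * tailPart K 1 ^ m) (N : ℕ) :
    V ^ N ≤ cliffordPart K 0 * tailPart K 1 ^ (m * N) := by
  induction N with
  | zero =>
    rw [mul_zero, pow_zero, pow_zero, mul_one]
    exact Submodule.one_le.2 (one_mem_cliffordPart K 0)
  | succ N ih =>
    rw [pow_succ, mul_add, mul_one]
    exact (mul_le_mul' ih hV).trans (clifford_tail_mul K Nat.zero_lt_one _ _)

end Reduction

/-! ### Superweight and action of the reduced words. -/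

section Heads

variable (K : Type*) [Field K]

/-- The ideal generated by the letters `x_i` with `i < n`. -/
noncomputable def lettersIdeal (n : ℕ) : Submodule K (Grassmann K) :=
  Submodule.span K {f | ∃ l : List ℕ, (∃ i ∈ l, i < n) ∧ mono K l = f}

variable {K}

theorem lettersIdeal_mono {m n : ℕ} (h : m ≤ n) : lettersIdeal K m ≤ lettersIdeal K n :=
  Submodule.span_mono fun _ ⟨l, ⟨i, hi, him⟩, hf⟩ => ⟨l, ⟨i, hi, him.trans_le h⟩, hf⟩

theorem gen_mul_mem_lettersIdeal (n : ℕ) (f : Grassmann K) :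
    gen K n * f ∈ lettersIdeal K (n + 1) := by
  have hf : f ∈ Submodule.span K (Set.range (mono K)) := span_mono_eq_top K ▸ trivial
  induction hf using Submodule.span_induction with
  | mem f hf =>
    obtain ⟨l, rfl⟩ := hf
    rw [← mono_cons]
    exact Submodule.subset_span ⟨_, ⟨n, by simp, by omega⟩, rfl⟩
  | zero => rw [mul_zero]; exact zero_mem _
  | add f g _ _ hf hg => rw [mul_add]; exact add_mem hf hg
  | smul c f _ hf => rw [mul_smul_comm]; exact Submodule.smul_mem _ c hf

variable (K)

/-- Homogeneous operators of superweight between `-n` and `n` that either are the identity or map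
all elements free of the letters `x_i`, `i < n`, to the ideal generated by these letters. -/
def headSet (n : ℕ) : Set (Module.End K (Grassmann K)) :=
  {w | ∃ s : ℤ, |s| ≤ n ∧ w ∈ shift K letterSwt s ∧ ((w = 1 ∧ s = 0) ∨
    ∀ f, (∀ i < n, partialD K i f = 0) → w f ∈ lettersIdeal K n)}

variable {K}

/-- The new factor acts first. On elements free of the letters up to `x_n`, a factor ending in `∂_n`
gives zero; `x_n` gives an element of the new ideal that is still free of the earlier letters, so
`w` keeps it in the ideal. -/
theorem mul_mem_headSet {n : ℕ} {w e : Module.End K (Grassmann K)} (hw : w ∈ headSet K n)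
    (he : e ∈ cliffordSet K n) : w * e ∈ headSet K (n + 1) := by
  obtain ⟨s, hs, hws, h⟩ := hw
  have hl : |letterSwt n| = 1 := by rcases letterSwt_eq_or n with h | h <;> simp [h]
  have hle : ((n + 1 : ℕ) : ℤ) = n + 1 := by push_cast; ring
  rcases he with rfl | rfl | rfl | rfl
  · refine ⟨s, by omega, by rwa [mul_one], ?_⟩
    rw [mul_one]
    refine h.imp_right fun h f hf => lettersIdeal_mono (Nat.le_succ n) (h f fun i hi => hf i ?_)
    omega
  · refine ⟨s + letterSwt n, ?_, mul_mem_shift hws (letter_mem_shift n), Or.inr fun f hf => ?_⟩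
    · have := abs_add_le s (letterSwt n); omega
    · rw [Module.End.mul_apply, letter_apply]
      rcases h with ⟨rfl, -⟩ | h
      · exact gen_mul_mem_lettersIdeal n f
      · refine lettersIdeal_mono (Nat.le_succ n) (h _ fun i hi => ?_)
        rw [partialD_gen_mul_of_ne (by omega), hf i (by omega), mul_zero, neg_zero]
  · refine ⟨s + -letterSwt n, ?_, mul_mem_shift hws (partialD_mem_shift n), Or.inr fun f hf => ?_⟩
    · have := abs_add_le s (-letterSwt n); rw [abs_neg] at this; omega
    · rw [Module.End.mul_apply, hf n (by omega), map_zero]; exact zero_mem _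
  · refine ⟨s, by omega, ?_, Or.inr fun f hf => ?_⟩
    · have := mul_mem_shift hws
        (mul_mem_shift (letter_mem_shift (K := K) n) (partialD_mem_shift n))
      rwa [add_neg_cancel, add_zero] at this
    · rw [Module.End.mul_apply, Module.End.mul_apply, hf n (by omega), map_zero, map_zero]
      exact zero_mem _

theorem headPart_le (n : ℕ) : headPart K n ≤ Submodule.span K (headSet K n) := by
  induction n with
  | zero =>
    rw [headPart, Submodule.one_le]
    exact Submodule.subset_span ⟨0, by simp, one_mem_shift _, Or.inl ⟨rfl, rfl⟩⟩
  | succ n ih =>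
    rw [headPart]
    refine (mul_le_mul' ih le_rfl).trans ?_
    rw [cliffordPart, Submodule.span_mul_span]
    refine Submodule.span_mono ?_
    rintro _ ⟨w, hw, e, he, rfl⟩
    exact mul_mem_headSet hw he

variable (K)

/-- Homogeneous operators of superweight between `-(n+2)` and `n+2` that either are the identity
or, if the superweight is zero, map `1` and the letters `x_j`, `j ≥ n`, to the ideal generated by
the letters `x_i`, `i < n`. -/
def wordSet (n : ℕ) : Set (Module.End K (Grassmann K)) :=
  {w | ∃ s : ℤ, |s| ≤ n + 2 ∧ w ∈ shift K letterSwt s ∧ (w = 1 ∨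
    (s = 0 → w 1 ∈ lettersIdeal K n ∧ ∀ j, n ≤ j → w (gen K j) ∈ lettersIdeal K n))}

variable {K}

theorem head_mul_tail_le (n : ℕ) :
    headPart K n * tailPart K n ≤ Submodule.span K (wordSet K n) := by
  refine (mul_le_mul' (headPart_le n) le_rfl).trans ?_
  rw [tailPart, Submodule.span_mul_span]
  refine Submodule.span_mono ?_
  rintro _ ⟨w, ⟨s, hs, hws, h⟩, q, hq, rfl⟩
  have hl : |letterSwt n| = 1 := by rcases letterSwt_eq_or n with h | h <;> simp [h]
  have hgen : ∀ j, n ≤ j → ∀ i < n, partialD K i (gen K j) = 0 := fun j hj i hi => by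
    rw [partialD_gen, if_neg (by omega), zero_smul]
  change w * q ∈ _
  rcases hq with rfl | rfl | rfl
  · rw [mul_one]
    refine ⟨s, by omega, hws, ?_⟩
    rcases h with ⟨rfl, -⟩ | h
    · exact Or.inl rfl
    · exact Or.inr fun _ => ⟨h 1 fun i _ => partialD_one K i, fun j hj => h _ (hgen j hj)⟩
  · refine ⟨s + -letterSwt n, ?_, mul_mem_shift hws (pivot_mem_shift n), Or.inr fun h0 => ?_⟩
    · have := abs_add_le s (-letterSwt n); rw [abs_neg] at this; omega
    · rcases h with ⟨-, rfl⟩ | h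
      -- With trivial head the word is `v_n`, whose superweight is not zero.
      · exfalso; rcases letterSwt_eq_or n with h | h <;> omega
      · refine ⟨?_, fun j hj => h _ fun i hi => ?_⟩
        · rw [Module.End.mul_apply, pivot_one, map_zero]; exact zero_mem _
        -- As `v_n` anticommutes with `∂_i` for `i < n`, it maps `x_j` to an element again free of
        -- the letters below `n`, to which the head property applies.
        · rw [← neg_eq_zero, ← pivot_partialD hi, hgen j hj i hi, map_zero]
  -- The operator `x_n v_{n+1}` has superweight `2` or `-2`, which accounts for the bound `n + 2`.
  · refine ⟨s + (letterSwt n + -letterSwt (n + 1)), ?_,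
      mul_mem_shift hws (mul_mem_shift (letter_mem_shift n) (pivot_mem_shift (n + 1))),
      Or.inr fun h0 => ?_⟩
    · have h1 := abs_add_le s (letterSwt n + letterSwt n)
      have h2 := abs_add_le (letterSwt n) (letterSwt n)
      rw [letterSwt_succ, neg_neg]; omega
    · rw [letterSwt_succ, neg_neg] at h0
      rcases h with ⟨-, rfl⟩ | h
      · exfalso; rcases letterSwt_eq_or n with h | h <;> omega
      · refine ⟨?_, fun j hj => h _ fun i hi => ?_⟩
        · rw [Module.End.mul_apply, pivotSq, Module.End.mul_apply, pivot_one, map_zero, map_zero]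
          exact zero_mem _
        · have h1 := LinearMap.congr_fun (pivotSq_mul_partialD K hi) (gen K j)
          rw [one_smul, Module.End.mul_apply, Module.End.mul_apply, hgen j hj i hi, map_zero] at h1
          exact h1.symm

end Heads

/-! ### Vanishing of long products of operators of one sign. -/

section SignedNilpotency

variable {K : Type*} [Field K]

/-- Products of `N` homogeneous operators whose superweights have the sign of `ε` are combinations
of homogeneous operators of superweight at least `N` in the direction of `ε`. -/
theorem pow_le_span_shift {T : Set (Module.End K (Grassmann K))} {ε : ℤ}
    (hT : ∀ w ∈ T, ∃ s : ℤ, 1 ≤ ε * s ∧ w ∈ shift K letterSwt s) (N : ℕ) :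
    Submodule.span K T ^ N ≤
      Submodule.span K {w | ∃ s : ℤ, N ≤ ε * s ∧ w ∈ shift K letterSwt s} := by
  induction N with
  | zero =>
    rw [pow_zero, Submodule.one_le]
    exact Submodule.subset_span ⟨0, by simp, one_mem_shift _⟩
  | succ N ih =>
    rw [pow_succ]
    refine (mul_le_mul' ih le_rfl).trans ?_
    rw [Submodule.span_mul_span]
    refine Submodule.span_mono ?_
    rintro _ ⟨w, ⟨s, hs, hw⟩, u, hu, rfl⟩
    obtain ⟨t, ht, hu⟩ := hT u hu
    exact ⟨s + t, by push_cast; rw [mul_add]; omega, mul_mem_shift hw hu⟩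

theorem exists_pow_eq_bot_of_signed {T : Set (Module.End K (Grassmann K))} (hfin : T.Finite)
    (hTA : T ⊆ algA K) {ε : ℤ} (hε : |ε| = 1)
    (hT : ∀ w ∈ T, ∃ s : ℤ, 1 ≤ ε * s ∧ w ∈ shift K letterSwt s) :
    ∃ n, Submodule.span K T ^ n = ⊥ := by
  obtain ⟨m, hm⟩ := exists_span_le_clifford_tail_pow hfin hTA
  -- A product of `e + 4` elements has length at most `m * (e + 4) ≤ 2 ^ e`, so it reduces to level
  -- `e + 1`, where superweights are at most `e + 3` in absolute value; yet its own is at least `e +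
  -- 4`.
  set e := 2 * m + 4 with he
  have hpow : m * (e + 4) ≤ 2 ^ e := by
    have h1 : m + 1 ≤ 2 ^ m := Nat.lt_two_pow_self
    have h2 : 2 ^ e = 2 ^ m * 2 ^ m * 16 := by rw [he]; ring
    nlinarith [Nat.mul_le_mul h1 h1]
  refine ⟨e + 4, le_bot_iff.1 ?_⟩
  have h1 := (pow_le_clifford_tail_pow hm (e + 4)).trans
    ((clifford_tail_pow_le K hpow).trans (head_mul_tail_le (e + 1)))
  have h2 := pow_le_span_shift hT (e + 4)
  have hdisj := (iSupIndep_shift (K := K) letterSwt).disjoint_biSup_biSup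
    (s := {s : ℤ | |s| ≤ (e + 1 : ℕ) + 2}) (t := {s : ℤ | (e + 4 : ℕ) ≤ ε * s}) (by
      refine Set.disjoint_left.2 fun s hs ht => ?_
      simp only [Set.mem_ofPred_eq] at hs ht
      have h3 := le_abs_self (ε * s)
      rw [abs_mul, hε, one_mul] at h3
      push_cast at hs ht
      omega)
  exact hdisj (h1.trans (Submodule.span_le.2 fun w ⟨s, hs, hw, _⟩ =>
      Submodule.mem_iSup_of_mem s (Submodule.mem_iSup_of_mem hs hw)))
    (h2.trans (Submodule.span_le.2 fun w ⟨s, hs, hw⟩ =>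
      Submodule.mem_iSup_of_mem s (Submodule.mem_iSup_of_mem hs hw)))

theorem exists_pow_eq_bot_of_sign {T : Set (Module.End K (Grassmann K))} (hfin : T.Finite)
    {σ : SignType} (hσ : σ ≠ 0)
    (hT : T ⊆ {w | w ∈ algA K ∧ ∃ s : ℤ, SignType.sign s = σ ∧ w ∈ shift K letterSwt s}) :
    ∃ n, Submodule.span K T ^ n = ⊥ := by
  refine exists_pow_eq_bot_of_signed hfin (fun w hw => (hT hw).1) (ε := (σ : ℤ)) ?_ fun w hw => ?_
  · cases σ
    · exact absurd rfl hσ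
    · rfl
    · rfl
  · obtain ⟨-, s, hs, hw⟩ := hT hw
    refine ⟨s, ?_, hw⟩
    subst hs
    rw [sign_mul_self]
    have : s ≠ 0 := by rintro rfl; exact hσ sign_zero
    exact Int.one_le_abs this

end SignedNilpotency

/-! ### Superweight zero: derivations raising a bounded filtration. -/

section ZeroNilpotency

variable (K : Type*) [Field K]

/-- The span of the products of letters of weight at least `k`. -/
noncomputable def weightFiltration (d : ℕ → ℕ) (k : ℕ) : Submodule K (Grassmann K) :=
  Submodule.span K {f | ∃ l, k ≤ listWeight d l ∧ mono K l = f}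

variable {K}

theorem mono_mem_weightFiltration {d : ℕ → ℕ} {k : ℕ} {l : List ℕ} (h : k ≤ listWeight d l) :
    mono K l ∈ weightFiltration K d k := Submodule.subset_span ⟨l, h, rfl⟩

theorem weightFiltration_anti (d : ℕ → ℕ) {k l : ℕ} (h : k ≤ l) :
    weightFiltration K d l ≤ weightFiltration K d k :=
  Submodule.span_mono fun _ ⟨m, hm, hf⟩ => ⟨m, h.trans hm, hf⟩

theorem mul_mem_weightFiltration {d : ℕ → ℕ} {k l : ℕ} {f g : Grassmann K}
    (hf : f ∈ weightFiltration K d k) (hg : g ∈ weightFiltration K d l) :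
    f * g ∈ weightFiltration K d (k + l) := by
  have h := Submodule.mul_mem_mul hf hg
  unfold weightFiltration at h
  rw [Submodule.span_mul_span] at h
  refine Submodule.span_mono ?_ h
  rintro _ ⟨_, ⟨a, ha, rfl⟩, _, ⟨b, hb, rfl⟩, rfl⟩
  refine ⟨a ++ b, ?_, mono_append K a b⟩
  rw [listWeight, List.map_append, List.sum_append]
  exact add_le_add ha hb

theorem gen_mul_mono_of_mem {i : ℕ} {l : List ℕ} (h : i ∈ l) : gen K i * mono K l = 0 := by
  induction l with
  | nil => simp at h
  | cons j l ih =>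
    rw [mono_cons]
    rcases List.mem_cons.1 h with rfl | h
    · exact gen_mul_gen_mul_self _ _
    · rw [gen_mul_gen_mul, ih h, mul_zero, neg_zero]

theorem nodup_of_mono_ne_zero {l : List ℕ} (h : mono K l ≠ 0) : l.Nodup := by
  induction l with
  | nil => exact List.nodup_nil
  | cons i l ih =>
    rw [mono_cons] at h
    exact List.nodup_cons.2 ⟨fun hi => h (gen_mul_mono_of_mem hi),
      ih fun h0 => h (by rw [h0, mul_zero])⟩

/-- A nonzero product of letters repeats none of them, so its weight is at most the sum of all
weights. -/
theorem weightFiltration_eq_bot {d : ℕ → ℕ} {n k : ℕ} (hd : ∀ i, n ≤ i → d i = 0)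
    (hk : ∑ i ∈ Finset.range n, d i < k) : weightFiltration K d k = ⊥ := by
  refine le_bot_iff.1 (Submodule.span_le.2 ?_)
  rintro _ ⟨l, hl, rfl⟩
  by_contra h
  have hnd := nodup_of_mono_ne_zero h
  rw [listWeight, ← List.sum_toFinset d hnd] at hl
  have h1 : ∑ i ∈ l.toFinset, d i ≤ ∑ i ∈ Finset.range n, d i :=
    Finset.sum_le_sum_of_ne_zero fun i _ hi => by
      rw [Finset.mem_range]
      by_contra hn
      exact hi (hd i (by omega))
  exact absurd (lt_of_lt_of_le hk hl) (not_lt.2 h1)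

variable (K)

/-- The operators that raise the weight filtration by `m`. -/
noncomputable def raising (d : ℕ → ℕ) (m : ℕ) : Submodule K (Module.End K (Grassmann K)) where
  carrier := {w | ∀ k, ∀ f ∈ weightFiltration K d k, w f ∈ weightFiltration K d (k + m)}
  add_mem' ha hb t f hf := add_mem (ha t f hf) (hb t f hf)
  zero_mem' _ _ _ := zero_mem _
  smul_mem' c _ ha t f hf := Submodule.smul_mem _ c (ha t f hf)

variable {K}

theorem pow_le_raising {d : ℕ → ℕ} {V : Submodule K (Module.End K (Grassmann K))}
    (hV : V ≤ raising K d 1) (N : ℕ) : V ^ N ≤ raising K d N := by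
  induction N with
  | zero =>
    rw [pow_zero, Submodule.one_le]
    exact fun k f hf => hf
  | succ N ih =>
    rw [pow_succ']
    refine Submodule.mul_le.2 fun a ha b hb k f hf => ?_
    rw [← add_assoc]
    exact hV ha _ _ (ih hb _ _ hf)

theorem raising_eq_bot {d : ℕ → ℕ} {n m : ℕ} (hd : ∀ i, n ≤ i → d i = 0)
    (hm : ∑ i ∈ Finset.range n, d i < m) : raising K d m = ⊥ := by
  refine le_bot_iff.1 fun w hw => ?_
  rw [Submodule.mem_bot]
  refine linearMap_ext_mono K fun l => ?_
  have h := hw 0 (mono K l) (mono_mem_weightFiltration (Nat.zero_le _))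
  rwa [zero_add, weightFiltration_eq_bot hd hm] at h

/-- An even superderivation that raises the weight of every letter raises the weight
filtration. -/
theorem mem_raising_of_gen {d : ℕ → ℕ} {D : Module.End K (Grassmann K)}
    (hD : D ∈ triangularDer K 0) (h : ∀ i, D (gen K i) ∈ weightFiltration K d (d i + 1)) :
    D ∈ raising K d 1 := by
  have key : ∀ l, D (mono K l) ∈ weightFiltration K d (listWeight d l + 1) := by
    intro l
    induction l with
    | nil => rw [mono_nil, triangularDer_one hD]; exact zero_mem _
    | cons i l ih =>
      rw [mono_cons, hD.1 1 _ (gen_mem_parity i), listWeight_cons]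
      refine add_mem ?_ (Submodule.smul_mem _ _ ?_)
      · have := mul_mem_weightFiltration (h i) (mono_mem_weightFiltration (K := K) (le_refl
          (listWeight d l)))
        rwa [add_right_comm] at this
      · have h1 : gen K i ∈ weightFiltration K d (d i) := by
          have := mono_mem_weightFiltration (K := K) (d := d) (k := d i) (l := [i]) (by simp)
          simpa [mono] using this
        have := mul_mem_weightFiltration h1 ih
        rwa [← add_assoc] at this
  intro k f hf
  induction hf using Submodule.span_induction with
  | mem f hf =>
    obtain ⟨l, hl, rfl⟩ := hf
    exact weightFiltration_anti d (by omega) (key l)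
  | zero => rw [map_zero]; exact zero_mem _
  | add f g _ _ hf hg => rw [map_add]; exact add_mem hf hg
  | smul c f _ hf => rw [map_smul]; exact Submodule.smul_mem _ c hf

/-- The weight function `i ↦ 2 n - i` on `i < n`, extended by zero. -/
def descendingWeight (n i : ℕ) : ℕ := if i < n then 2 * n - i else 0

theorem lettersIdeal_le_weightFiltration (n : ℕ) :
    lettersIdeal K n ≤ weightFiltration K (descendingWeight n) 1 := by
  refine Submodule.span_mono ?_
  rintro _ ⟨l, ⟨i, hi, hin⟩, rfl⟩
  refine ⟨l, ?_, rfl⟩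
  have h1 : descendingWeight n i ≤ listWeight (descendingWeight n) l :=
    List.single_le_sum (by simp) _ (List.mem_map_of_mem hi)
  have h2 : 1 ≤ descendingWeight n i := by rw [descendingWeight, if_pos hin]; omega
  omega

/-- A combination of products of letters below `x_i` that has the superweight of `x_i` has greater
descending weight than `x_i`. -/
theorem below_inf_component_le {n i : ℕ} (hi : i < n) {f : Grassmann K} (hf : f ∈ below K i)
    (hf' : f ∈ component K letterSwt (letterSwt i)) :
    f ∈ weightFiltration K (descendingWeight n) (descendingWeight n i + 1) := by
  refine Submodule.span_le.2 ?_ (mem_span_inter_of_iSupIndep (iSupIndep_component letterSwt)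
    (by rintro g ⟨l, -, rfl⟩; exact ⟨_, mono_mem_component _ l⟩) hf hf')
  rintro _ ⟨⟨l, hl, rfl⟩, hlc⟩
  by_cases h : listWeight letterSwt l = letterSwt i
  · refine mono_mem_weightFiltration ?_
    have hd : ∀ j, j < i → descendingWeight n j = 2 * n - j := fun j hj => by
      rw [descendingWeight, if_pos (by omega)]
    have hdi : descendingWeight n i = 2 * n - i := by rw [descendingWeight, if_pos hi]
    -- Superweight `1` or `-1` excludes lists of length zero and two. A single earlier letter is
    -- heavier than `x_i`, and three letters below `n` weigh more than `3 n`, whereas `x_i` weighs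
    -- at most `2 n`.
    match l, hl, h with
    | [], _, h => exfalso; rcases letterSwt_eq_or i with h1 | h1 <;> simp [h1] at h
    | [a], hl, _ =>
      have ha := hl a (by simp)
      rw [listWeight_cons, listWeight_nil, hd a ha, hdi]
      omega
    | [a, b], _, h =>
      exfalso
      rw [listWeight_cons, listWeight_cons, listWeight_nil] at h
      rcases letterSwt_eq_or i with h1 | h1 <;> rcases letterSwt_eq_or a with h2 | h2 <;>
        rcases letterSwt_eq_or b with h3 | h3 <;> omega
    | a :: b :: c :: l, hl, _ =>
      have ha := hl a (by simp)
      have hb := hl b (by simp)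
      have hc := hl c (by simp)
      rw [listWeight_cons, listWeight_cons, listWeight_cons, hd a ha, hd b hb, hd c hc, hdi]
      omega
  · have h0 : mono K l = 0 := Submodule.disjoint_def.1
      ((iSupIndep_component letterSwt).pairwiseDisjoint h) _ (mono_mem_component _ l) hlc
    rw [h0]
    exact zero_mem _

theorem algebraMapInv_lettersIdeal {n : ℕ} {f : Grassmann K} (hf : f ∈ lettersIdeal K n) :
    ExteriorAlgebra.algebraMapInv f = (0 : K) := by
  have hgen : ∀ i, ExteriorAlgebra.algebraMapInv (gen K i) = (0 : K) := fun i =>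
    ExteriorAlgebra.lift_ι_apply K _ _ _
  induction hf using Submodule.span_induction with
  | mem f hf =>
    obtain ⟨l, ⟨i, hi, -⟩, rfl⟩ := hf
    cases l with
    | nil => simp at hi
    | cons j l => rw [mono_cons, map_mul, hgen, zero_mul]
  | zero => rw [map_zero]
  | add f g _ _ hf hg => rw [map_add, hf, hg, add_zero]
  | smul c f _ hf => rw [map_smul, hf, smul_zero]

/-- Derivations of superweight zero in the span of the word set of level `n` map the letters `x_j`,
`j ≥ n`, to the ideal generated by the letters `x_i`, `i < n`. -/
theorem gen_mem_lettersIdeal_of_mem_span_wordSet {n : ℕ} {D : Module.End K (Grassmann K)}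
    (hD : D ∈ Submodule.span K (wordSet K n)) (h0 : D ∈ shift K letterSwt 0) (h1 : D 1 = 0)
    {j : ℕ} (hj : n ≤ j) : D (gen K j) ∈ lettersIdeal K n := by
  have h := mem_span_inter_of_iSupIndep (iSupIndep_shift letterSwt)
    (by rintro g ⟨s, -, hs, -⟩; exact ⟨s, hs⟩) hD h0
  -- The scalar `c` is the coefficient of the identity: modulo the ideal, `D` multiplies both `1`
  -- and `x_j` by it. A derivation kills `1`, and the augmentation vanishes on the ideal, which
  -- forces `c = 0`.
  have key : ∃ c : K, D 1 - c • 1 ∈ lettersIdeal K n ∧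
      D (gen K j) - c • gen K j ∈ lettersIdeal K n := by
    clear h1 hD h0
    induction h using Submodule.span_induction with
    | mem w hw =>
      obtain ⟨⟨s, -, hs, hw⟩, hw0⟩ := hw
      by_cases hs0 : s = 0
      · rcases hw with rfl | hw
        · exact ⟨1, by simp, by simp⟩
        · exact ⟨0, by simpa using (hw hs0).1, by simpa using (hw hs0).2 j hj⟩
      · have : w = 0 := Submodule.disjoint_def.1
          ((iSupIndep_shift letterSwt).pairwiseDisjoint hs0) w hs hw0
        subst this
        exact ⟨0, by simp, by simp⟩
    | zero => exact ⟨0, by simp, by simp⟩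
    | add f g _ _ hf hg =>
      obtain ⟨c, h1, h2⟩ := hf
      obtain ⟨c', h1', h2'⟩ := hg
      refine ⟨c + c', ?_, ?_⟩
      · rw [LinearMap.add_apply, add_smul, add_sub_add_comm]; exact add_mem h1 h1'
      · rw [LinearMap.add_apply, add_smul, add_sub_add_comm]; exact add_mem h2 h2'
    | smul a f _ hf =>
      obtain ⟨c, h1, h2⟩ := hf
      refine ⟨a * c, ?_, ?_⟩
      · rw [LinearMap.smul_apply, mul_smul, ← smul_sub]; exact Submodule.smul_mem _ a h1
      · rw [LinearMap.smul_apply, mul_smul, ← smul_sub]; exact Submodule.smul_mem _ a h2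
  obtain ⟨c, h2, h3⟩ := key
  have hc : c = 0 := by
    have h4 := algebraMapInv_lettersIdeal h2
    rw [h1, map_sub, map_zero, map_smul, map_one, zero_sub, neg_eq_zero, smul_eq_mul,
      mul_one] at h4
    exact h4
  rwa [hc, zero_smul, sub_zero] at h3

/-- Membership in `lieR`, not only in `algA`, is essential to the argument: it makes the operators
triangular derivations, so that raising the weight need only be checked on letters. Triangularity
settles the letters below level `m + 1`, and word reduction the others. -/
theorem exists_pow_eq_bot_of_lieR {T : Set (Module.End K (Grassmann K))} (hfin : T.Finite)
    (hT : T ⊆ {w | w ∈ lieR K ∧ ∃ s : ℤ, SignType.sign s = 0 ∧ w ∈ shift K letterSwt s}) :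
    ∃ n, Submodule.span K T ^ n = ⊥ := by
  obtain ⟨m, hm⟩ := exists_span_le_clifford_tail_pow hfin fun w hw => lieR_le_algA (hT hw).1
  have hm' := hm.trans ((clifford_tail_pow_le K Nat.lt_two_pow_self.le).trans
    (head_mul_tail_le (m + 1)))
  have hraise : Submodule.span K T ≤ raising K (descendingWeight (m + 1)) 1 := by
    refine Submodule.span_le.2 fun D hD => ?_
    obtain ⟨hR, s, hs, h0⟩ := hT hD
    rw [sign_eq_zero_iff] at hs
    subst hs
    have hder := mem_triangularDer_zero_of_mem_lieR hR h0
    refine mem_raising_of_gen hder fun i => ?_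
    by_cases hi : i < m + 1
    · refine below_inf_component_le hi (hder.2 i) ?_
      have h1 : gen K i ∈ component K letterSwt (letterSwt i) := by
        have := mono_mem_component (K := K) letterSwt [i]
        simpa [mono] using this
      simpa using h0 _ _ h1
    · have h1 : descendingWeight (m + 1) i = 0 := by rw [descendingWeight, if_neg hi]
      rw [h1, zero_add]
      exact lettersIdeal_le_weightFiltration _ (gen_mem_lettersIdeal_of_mem_span_wordSet
        (hm' (Submodule.subset_span hD)) h0 (triangularDer_one hder) (by omega))
  -- One more than the largest weight of a squarefree product of letters.
  refine ⟨∑ i ∈ Finset.range (m + 1), descendingWeight (m + 1) i + 1,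
    le_bot_iff.1 ((pow_le_raising hraise _).trans_eq ?_)⟩
  exact raising_eq_bot (n := m + 1) (fun i hi => by rw [descendingWeight, if_neg (by omega)])
    (Nat.lt_succ_self _)

end ZeroNilpotency

end GrassmannPivot

open GrassmannPivot in
theorem theorem10p3 (K : Type*) [Field K] :
    -- the associative hull: direct sum of three subalgebras, `A_+` and `A_-` locally nilpotent
    ((iSup (signPart (algA K)) = algA K ∧ iSupIndep (signPart (algA K)) ∧
        ∀ σ, ∀ x ∈ signPart (algA K) σ, ∀ y ∈ signPart (algA K) σ,
          x * y ∈ signPart (algA K) σ) ∧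
      IsLocallyNilpotentAssoc (signPart (algA K) 1) ∧
      IsLocallyNilpotentAssoc (signPart (algA K) (-1))) ∧
    -- the Lie superalgebra: direct sum of three locally nilpotent subalgebras
    ((iSup (signPart (lieR K)) = lieR K ∧ iSupIndep (signPart (lieR K)) ∧
        ∀ σ, IsLieSuperSubalgebra (signPart (lieR K) σ)) ∧
      IsLocallyNilpotentLie (signPart (lieR K) 1) ∧
      IsLocallyNilpotentLie (signPart (lieR K) 0) ∧
      IsLocallyNilpotentLie (signPart (lieR K) (-1))) := by
  have hA : ∀ σ : SignType, σ ≠ 0 → IsLocallyNilpotentAssoc (signPart (algA K) σ) := fun σ hσ =>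
    isLocallyNilpotentAssoc_signPart fun T hfin hT => exists_pow_eq_bot_of_sign hfin hσ hT
  have hR : ∀ σ : SignType, σ ≠ 0 → IsLocallyNilpotentLie (signPart (lieR K) σ) := fun σ hσ =>
    isLocallyNilpotentLie_signPart fun T hfin hT =>
      exists_pow_eq_bot_of_sign hfin hσ fun w hw => ⟨lieR_le_algA (hT hw).1, (hT hw).2⟩
  exact ⟨⟨⟨iSup_signPart algA_le_span_monomials, iSupIndep_signPart _,
      fun σ x hx y hy => mul_mem_signPart_algA hx hy⟩, hA 1 (by decide), hA (-1) (by decide)⟩,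
    ⟨iSup_signPart lieR_le_span_monomials, iSupIndep_signPart _,
      isLieSuperSubalgebra_signPart_lieR⟩, hR 1 (by decide),
    isLocallyNilpotentLie_signPart fun T hfin hT => exists_pow_eq_bot_of_lieR hfin hT,
    hR (-1) (by decide)⟩
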